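/- Let $\mathscr{H}$ be a complex Hilbert space, let $\mathfrak{A}=\mathbb{K}(\mathscr{H})$ be the $C^*$-algebra of compact operators on $\mathscr{H}$, let $\mathscr{X}$ be a (right) Hilbert $\mathfrak{A}$-module with inner product $\langle\cdot,\cdot\rangle$ (linear in the second variable), and let $x=(x_1,\dots,x_n)\in\mathscr{X}^n$. Write $|a|^2=a^*a$ for $a\in\mathfrak{A}$. Notation. For a Hilbert $C^*$-module $\mathscr{Y}$ (in particular, for a Hilbert space, regarded as a Hilbert $\mathbb{C}$-module) and $y\in\mathscr{Y}^n$, let $$\|y\|_n^{\mathscr{Y}}=\sup\|P_1y_1+\dots+P_ny_n\|,$$ where the supremum is over all families $(P_1,\dots,P_n)$ of mutually orthogonal projections (possibly zero) in the algebra $\mathcal{L}(\mathscr{Y})$ of adjointable maps with $\sum_iP_i=I_{\mathscr{Y}}$. Let $\mathcal{P}(\mathfrak{A})$ be the set of pure states of $\mathfrak{A}$; for $\tau\in\mathcal{P}(\mathfrak{A})$ let $\mathcal{N}_\tau=\{z\in\mathscr{X}:\tau(\langle z,z\rangle)=0\}$, and let $\mathscr{H}_\tau$ be the Hilbert completion of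 $\mathscr{X}/\mathcal{N}_\tau$ for the inner product $\langle z+\mathcal{N}_\tau,w+\mathcal{N}_\tau\rangle=\tau(\langle z,w\rangle)$. Put $$\|x\|_n^{\mathcal{P}(\mathfrak{A})}=\sup_{\tau\in\mathcal{P}(\mathfrak{A})}\|(x_1+\mathcal{N}_\tau,\dots,x_n+\mathcal{N}_\tau)\|_n^{\mathscr{H}_\tau}.$$ For $y\in\mathscr{X}^n$ put $$\mu_n^*(y)=\sup_{z\in\mathscr{X},\,\|z\|\le1}\Big\|\Big(\sum_{i=1}^n|\langle y_i,z\rangle|^2\Big)^{1/2}\Big\|,\qquad \|x\|_n^*=\sup\Big\{\Big\|\sum_{i=1}^n|\langle y_i,x_i\rangle|^2\Big\|^{1/2}:y\in\mathscr{X}^n,\ \mu_n^*(y)\le1\Big\}.$$ The suprema are taken in $[0,\infty)$, with $\sup\emptyset=0$. A minimal projection of $\mathfrak{A}$ is a nonzero projection $e$ with $e\mathfrak{A}e=\mathbb{C}e$. An orthonormal basis of $\mathscr{X}$ is a set of mutually orthogonal elements $u$, each with $\langle u,u\rangle$ a minimal projection, that generates a dense submodule; o-dim$(\mathscr{X})$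 is the cardinality of any orthonormal basis of $\mathscr{X}$, and o-dim$(\mathscr{H})$ is the Hilbert dimension of $\mathscr{H}$. Theorem. (1) $\|x\|_n^{\mathscr{X}}=\|x\|_n^{\mathcal{P}(\mathfrak{A})}$. (2) If $\mathscr{H}$ is separable and o-dim$(\mathscr{X})\ge n\cdot$o-dim$(\mathscr{H})$, then $\|x\|_n^{\mathscr{X}}=\|x\|_n^*$. -/

import Mathlib

open scoped ComplexOrder

universe u v

noncomputable section

namespace HilbertMulti

/-! ### The C⋆-algebra of compact operators -/

section Compact

variable (H : Type*) [NormedAddCommGroup H] [InnerProductSpace ℂ H] [CompleteSpace H]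

/-- Schauder: the adjoint of a compact operator on a Hilbert space is compact. -/
theorem isCompactOperator_adjoint {T : H →L[ℂ] H} (hT : IsCompactOperator T) :
    IsCompactOperator (ContinuousLinearMap.adjoint T) := by
  set S := ContinuousLinearMap.adjoint T with hS
  have hTS : IsCompactOperator (T ∘L S) := hT.comp_clm S
  rw [show (⇑S : H → H) = ⇑(S : H →ₗ[ℂ] H) from rfl,
    isCompactOperator_iff_isCompact_closure_image_closedBall (S : H →ₗ[ℂ] H) zero_lt_one]
  have h1 : TotallyBounded ((T ∘L S) '' Metric.closedBall (0 : H) 1) :=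
    ((IsCompactOperator.isCompact_closure_image_closedBall (f := ((T ∘L S : H →L[ℂ] H) : H →ₗ[ℂ] H))
      hTS 1).totallyBounded).subset subset_closure
  refine TotallyBounded.isCompact_of_isClosed (TotallyBounded.closure ?_) isClosed_closure
  rw [Metric.totallyBounded_iff]
  intro ε hε
  obtain ⟨t, htS, htf, htc⟩ :=
    Metric.finite_approx_of_totallyBounded h1 (ε ^ 2 / 2) (by positivity)
  obtain ⟨t', ht'S, ht'f, htc⟩ := Set.exists_subset_image_finite_and
    (p := fun t => (T ∘L S) '' Metric.closedBall (0 : H) 1 ⊆ ⋃ y ∈ t, Metric.ball y (ε ^ 2 / 2))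
    |>.1 ⟨t, htS, htf, htc⟩
  refine ⟨S '' t', ht'f.image _, ?_⟩
  rintro _ ⟨x, hx, rfl⟩
  have hx' := htc (Set.mem_image_of_mem _ hx)
  simp only [Set.mem_iUnion] at hx'
  obtain ⟨y, hy, hxy⟩ := hx'
  obtain ⟨z, hz, rfl⟩ := hy
  simp only [Set.mem_iUnion]
  refine ⟨S z, Set.mem_image_of_mem _ hz, ?_⟩
  rw [Metric.mem_ball, dist_eq_norm] at hxy ⊢
  have e1 : ‖S x - S z‖ ^ 2 ≤ ‖T (S (x - z))‖ * ‖x - z‖ := by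
    rw [← map_sub, ← inner_self_eq_norm_sq (𝕜 := ℂ)]
    have : inner ℂ (S (x - z)) (S (x - z)) = inner ℂ (T (S (x - z))) (x - z) := by
      rw [hS, ContinuousLinearMap.adjoint_inner_right]
    rw [this]
    exact (RCLike.re_le_norm _).trans (norm_inner_le_norm _ _)
  have e2 : ‖x - z‖ ≤ 2 := by
    have h3 := ht'S hz
    rw [mem_closedBall_zero_iff] at h3 hx
    exact (norm_sub_le _ _).trans (by linarith)
  have e3 : ‖T (S (x - z))‖ < ε ^ 2 / 2 := by simpa using hxy
  have e4 : ‖S x - S z‖ ^ 2 < ε ^ 2 := by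
    nlinarith [norm_nonneg (T (S (x - z))), norm_nonneg (x - z)]
  exact lt_of_pow_lt_pow_left₀ 2 hε.le e4

/-- The compact operators on a Hilbert space, as a ⋆-subalgebra of the bounded operators. -/
def compactSubalgebra : NonUnitalStarSubalgebra ℂ (H →L[ℂ] H) where
  carrier := {T | IsCompactOperator T}
  add_mem' hS hT := IsCompactOperator.add hS hT
  zero_mem' := isCompactOperator_zero
  mul_mem' {S} {_} _ hT := IsCompactOperator.clm_comp hT S
  smul_mem' c _ hT := IsCompactOperator.smul hT c
  star_mem' hT := isCompactOperator_adjoint H hT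

/-- The algebra `𝕂(H)`. Its norm is the operator norm and its order is the Loewner order, both
inherited from the bounded operators. -/
abbrev CompactOp : Type _ := ↥(compactSubalgebra H)

/-- This makes `CompactOp H` a `NonUnitalCStarAlgebra`. -/
instance isClosed_compactSubalgebra :
    IsClosed (compactSubalgebra H : Set (H →L[ℂ] H)) :=
  isClosed_setOfPred_isCompactOperator

end Compact

/-! ### The Hilbert C⋆-multi-norm

The definitions in this section do not depend on the order of multiplication in the algebra. -/

section HilbertMultiNorm

variable (A : Type*) {X : Type*} [NonUnitalCStarAlgebra A] [PartialOrder A]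
  [NormedAddCommGroup X] [NormedSpace ℂ X] [SMul A X] [CStarModule A X]

/-- `P : X → X` is a projection in the C⋆-algebra of adjointable maps: it is its own adjoint
and idempotent. (Adjointable maps are automatically linear and bounded.) -/
structure IsProjection (P : X → X) : Prop where
  self_adjoint : ∀ x y : X, inner A (P x) y = inner A x (P y)
  idempotent : ∀ x : X, P (P x) = P x

/-- A family of mutually orthogonal projections (some may vanish) summing to the identity. -/
structure IsProjectionDecomposition {n : ℕ} (P : Fin n → X → X) : Prop where
  isProjection : ∀ i, IsProjection A (P i)
  orthogonal : ∀ i j, i ≠ j → ∀ x : X, P i (P j x) = 0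
  sum_eq : ∀ x : X, ∑ i, P i x = x

/-- The Hilbert C⋆-multi-norm `‖(x₁, …, xₙ)‖ₙ^X`. -/
def hilbertMultiNorm {n : ℕ} (x : Fin n → X) : ℝ :=
  sSup {r : ℝ | ∃ P : Fin n → X → X, IsProjectionDecomposition A P ∧ r = ‖∑ i, P i (x i)‖}

end HilbertMultiNorm

/-! ### Right Hilbert C⋆-modules

Mathlib's `CStarModule B X` satisfies `⟪x, b • y⟫ = b * ⟪x, y⟫` with an inner product that is linear
in the second variable. Hence a right Hilbert `A`-module, with `⟪x, y a⟫ = ⟪x, y⟫ a`, is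
`CStarModule Aᵐᵒᵖ X`, where the right action is `x a = MulOpposite.op a • x` and the `A`-valued
inner product is `rinner A x y` below. -/

section Right

variable (A : Type*) {X : Type*} [NonUnitalCStarAlgebra A] [PartialOrder A]
  [NormedAddCommGroup X] [NormedSpace ℂ X] [SMul Aᵐᵒᵖ X] [CStarModule Aᵐᵒᵖ X]

/-- The `A`-valued inner product of a right Hilbert `A`-module. -/
def rinner (x y : X) : A := MulOpposite.unop (inner Aᵐᵒᵖ x y)

theorem rinner_op_smul_right (x y : X) (a : A) :
    rinner A x (MulOpposite.op a • y) = rinner A x y * a := by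
  simp [rinner]

theorem star_rinner (x y : X) : star (rinner A x y) = rinner A y x := by
  simp [rinner, ← MulOpposite.unop_star]

theorem rinner_self_nonneg (x : X) : 0 ≤ rinner A x x :=
  MulOpposite.unop_nonneg.2 CStarModule.inner_self_nonneg

theorem rinner_add_right (x y z : X) : rinner A x (y + z) = rinner A x y + rinner A x z := by
  simp [rinner]

theorem rinner_add_left (x y z : X) : rinner A (x + y) z = rinner A x z + rinner A y z := by
  simp [rinner]

theorem rinner_smul_right (c : ℂ) (x y : X) : rinner A x (c • y) = c • rinner A x y := by
  simp [rinner]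

theorem rinner_smul_left (c : ℂ) (x y : X) : rinner A (c • x) y = star c • rinner A x y := by
  simp [rinner]

/-- `μₙ*(x₁, …, xₙ) = sup_{‖y‖ ≤ 1} ‖(∑ |⟨xᵢ, y⟩|²)^{1/2}‖`, where `|a|² = a⋆ a`. -/
def muStar {n : ℕ} (x : Fin n → X) : ℝ :=
  sSup {r : ℝ | ∃ y : X, ‖y‖ ≤ 1 ∧
    r = √‖∑ i, star (rinner A (x i) y) * rinner A (x i) y‖}

/-- `‖x‖ₙ* = sup {‖∑ |⟨yᵢ, xᵢ⟩|²‖^{1/2} : μₙ*(y₁, …, yₙ) ≤ 1}`. -/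
def starMultiNorm {n : ℕ} (x : Fin n → X) : ℝ :=
  sSup {r : ℝ | ∃ y : Fin n → X, muStar A y ≤ 1 ∧
    r = √‖∑ i, star (rinner A (y i) (x i)) * rinner A (y i) (x i)‖}

end Right

/-! ### Pure states and localizations -/

section PureStates

/-- A bounded linear functional is positive if it is nonnegative on positive elements. -/
def IsPositiveFunctional {A : Type*} [NonUnitalCStarAlgebra A] [PartialOrder A]
    (τ : A →L[ℂ] ℂ) : Prop :=
  ∀ a : A, 0 ≤ a → 0 ≤ τ a

/-- Pure states: positive functionals of norm one such that every positive functional `ρ ≤ τ` is of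
the form `t τ` with `0 ≤ t ≤ 1`. -/
structure PureState (A : Type*) [NonUnitalCStarAlgebra A] [PartialOrder A] where
  toFunctional : A →L[ℂ] ℂ
  positive : IsPositiveFunctional toFunctional
  norm_eq_one : ‖toFunctional‖ = 1
  pure : ∀ ρ : A →L[ℂ] ℂ, IsPositiveFunctional ρ → IsPositiveFunctional (toFunctional - ρ) →
    ∃ t : ℝ, 0 ≤ t ∧ t ≤ 1 ∧ ρ = (t : ℂ) • toFunctional

variable {A : Type*} [NonUnitalCStarAlgebra A] [PartialOrder A]

/-- A copy of `X`, to carry the semi-inner product `τ(⟨x, y⟩)`. -/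
def PreLocalization (_τ : PureState A) (X : Type*) : Type _ := X

variable (τ : PureState A) (X : Type*) [NormedAddCommGroup X] [NormedSpace ℂ X]

instance : AddCommGroup (PreLocalization τ X) := inferInstanceAs (AddCommGroup X)

instance : Module ℂ (PreLocalization τ X) := inferInstanceAs (Module ℂ X)

variable [SMul Aᵐᵒᵖ X] [CStarModule Aᵐᵒᵖ X]

theorem conj_functional_rinner (x y : X) :
    star (τ.toFunctional (rinner A y x)) = τ.toFunctional (rinner A x y) := by
  have key : ∀ z : X, (τ.toFunctional (rinner A z z)).im = 0 := fun z =>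
    ((Complex.nonneg_iff.1 (τ.positive _ (rinner_self_nonneg A z))).2).symm
  have hx := key x
  have hy := key y
  have h1 := key (x + y)
  have h2 := key (x + Complex.I • y)
  simp only [rinner_add_right, rinner_add_left, rinner_smul_right, rinner_smul_left, map_add,
    map_smul, smul_eq_mul, Complex.add_im, Complex.star_def, Complex.conj_I, Complex.mul_im,
    Complex.add_re, Complex.mul_re, Complex.neg_re, Complex.neg_im, Complex.I_re, Complex.I_im, hx, hy] at h1 h2
  apply Complex.ext
  · simp only [Complex.star_def, Complex.conj_re]
    linarith
  · simp only [Complex.star_def, Complex.conj_im]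
    linarith

/-- The semi-inner product `⟨x, y⟩_τ = τ(⟨x, y⟩)`. -/
abbrev preLocalizationCore : PreInnerProductSpace.Core ℂ (PreLocalization τ X) where
  inner x y := τ.toFunctional (rinner (X := X) A x y)
  conj_inner_symm x y := conj_functional_rinner τ X x y
  re_inner_nonneg x :=
    (Complex.nonneg_iff.1 (τ.positive _ (rinner_self_nonneg (X := X) A x))).1
  add_left x y z :=
    (congrArg τ.toFunctional (rinner_add_left (X := X) A x y z)).trans (map_add _ _ _)
  smul_left x y c :=
    (congrArg τ.toFunctional (rinner_smul_left (X := X) A c x y)).trans (map_smul _ _ _)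

instance : SeminormedAddCommGroup (PreLocalization τ X) :=
  InnerProductSpace.Core.toSeminormedAddCommGroup (c := preLocalizationCore τ X)

instance : InnerProductSpace ℂ (PreLocalization τ X) :=
  InnerProductSpace.ofCore (preLocalizationCore τ X)

/-- The Hilbert space `H_τ`. The Hausdorff completion of `X` for the seminorm `τ(⟨x, x⟩)^{1/2}` is
the Hilbert completion of `X / N_τ`, where `N_τ = {x | τ(⟨x, x⟩) = 0}`. -/
abbrev Localization : Type _ := UniformSpace.Completion (PreLocalization τ X)

variable {X} in
/-- The class `x + N_τ` in `H_τ`. -/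
def toLocalization (x : X) : Localization τ X :=
  UniformSpace.Completion.coe' (show PreLocalization τ X from x)

theorem inner_toLocalization (x y : X) :
    inner ℂ (toLocalization τ x) (toLocalization τ y) = τ.toFunctional (rinner A x y) :=
  UniformSpace.Completion.inner_coe (𝕜 := ℂ) (E := PreLocalization τ X) x y

theorem toLocalization_eq_zero_iff (x : X) :
    toLocalization τ x = 0 ↔ τ.toFunctional (rinner A x x) = 0 := by
  rw [← inner_toLocalization, inner_self_eq_zero]

variable (A) {X} in
/-- `‖x‖ₙ^{P(A)}`: the supremum over all pure states `τ` of the Hilbert multi-norm of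
`(x₁ + N_τ, …, xₙ + N_τ)` in the Hilbert space `H_τ`. -/
def pureStateMultiNorm {n : ℕ} (x : Fin n → X) : ℝ :=
  sSup {r : ℝ | ∃ τ : PureState A,
    r = hilbertMultiNorm ℂ (fun i => toLocalization τ (x i))}

end PureStates

/-! ### Orthogonal dimension -/

section Dimension

/-- A minimal projection of `A`: a nonzero projection `e` with `e A e = ℂ e`. -/
structure IsMinimalProjection {A : Type*} [NonUnitalCStarAlgebra A] (e : A) : Prop where
  isStarProjection : IsStarProjection e
  ne_zero : e ≠ 0
  corner : ∀ a : A, ∃ c : ℂ, e * a * e = c • e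

variable (A X : Type*) [NonUnitalCStarAlgebra A] [PartialOrder A]
  [NormedAddCommGroup X] [NormedSpace ℂ X] [SMul Aᵐᵒᵖ X] [CStarModule Aᵐᵒᵖ X]

/-- An orthonormal basis of a right Hilbert `A`-module: mutually orthogonal vectors `u` for which
`⟨u, u⟩` is a minimal projection, generating a dense submodule. -/
structure IsOrthonormalBasis (S : Set X) : Prop where
  basic : ∀ u ∈ S, IsMinimalProjection (rinner A u u)
  orthogonal : ∀ u ∈ S, ∀ v ∈ S, u ≠ v → rinner A u v = 0
  dense : Dense (Submodule.span ℂ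
    (S ∪ {x : X | ∃ u ∈ S, ∃ a : A, x = MulOpposite.op a • u}) : Set X)

/-- The orthogonal dimension of a right Hilbert `A`-module: the cardinality of its orthonormal
bases. -/
def orthDim : Cardinal :=
  sInf {c : Cardinal | ∃ S : Set X, IsOrthonormalBasis A X S ∧ c = Cardinal.mk S}

/-- The Hilbert dimension of a Hilbert space: the cardinality of its orthonormal bases. -/
def hilbertDim (H : Type*) [NormedAddCommGroup H] [InnerProductSpace ℂ H] : Cardinal :=
  sInf {c : Cardinal | ∃ S : Set H, Orthonormal ℂ (Subtype.val : S → H) ∧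
    Dense (Submodule.span ℂ S : Set H) ∧ c = Cardinal.mk S}

end Dimension

end HilbertMulti

end

noncomputable section

namespace HilbertMulti

/-! ### Rank-one operators and approximation of compact operators -/

section RankOne

variable {H : Type*} [NormedAddCommGroup H] [InnerProductSpace ℂ H]

/-! Write |η⟩⟨ξ| for `rankOneOp η ξ` and [x] for the class of x in a localization. Everything
reduces to Hilbert space geometry, because a Hilbert 𝕂(H)-module is a space of operators.

The pure states of 𝕂(H) are the vector states of unit vectors (`vectorState`,
`exists_eq_vectorState`). Fix a unit vector ζ and let K be the localization at its state. Then x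
acts as the operator η ↦ [x |η⟩⟨ζ|] from H to K. This representation `toOp` is isometric and carries
⟨x, y⟩ to x⋆y (`inner_toOp`). Its range is closed, contains every rank-one operator and is stable
under left multiplication by bounded operators on K. Hence projections on K lift to X
(`exists_lifted_decomposition`), while projections on X descend to every localization
(`exists_induced_decomposition`).

For (1), lifting bounds the Hilbert multi-norm of each localization by that of X. Descending gives
the reverse bound, since the norm of X is the supremum of the localization norms.

For (2), a decomposition Q of K gives the normalized vectors of Qᵢ[xᵢ]. Carried back to X as
rank-one operators, they form an admissible y that does at least as well as Q
(`exists_muStar_le_one`). Conversely, evaluating an admissible y at ζ gives a family kᵢ in K that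
satisfies a Bessel inequality, and ∑ |⟨kᵢ, [xᵢ]⟩|² has to be bounded by the squared multi-norm in K.
For orthonormal kᵢ this is clear: complete the rank-one projections to a decomposition. In general,
write kᵢ by singular values in [-1, 1]. The norm of the vector of pairings is convex in these
values, so some choice of signs ±1 does at least as well, and signs give an orthonormal family
(`exists_orthonormal_sum_le`).

The last step needs n orthonormal vectors in K. If dim K were less than n, an orthonormal basis of K
would yield an orthonormal basis of X with fewer than n elements (`orthDim_le_finrank`). The
dimension hypothesis excludes this when H ≠ 0. -/

theorem isCompactOperator_rankOne (η ξ : H) :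
    IsCompactOperator (InnerProductSpace.rankOne ℂ η ξ : H →L[ℂ] H) := by
  rw [InnerProductSpace.rankOne_def']
  exact (isCompactOperator_of_locallyCompactSpace_rng
    (ContinuousLinearMap.toSpanSingleton ℂ η)).comp_clm _

variable [CompleteSpace H]

/-- The rank-one operator `ζ ↦ ⟨ξ, ζ⟩ η` as an element of `𝕂(H)`. -/
def rankOneOp (η ξ : H) : CompactOp H :=
  ⟨InnerProductSpace.rankOne ℂ η ξ, isCompactOperator_rankOne η ξ⟩

@[simp] theorem coe_rankOneOp (η ξ : H) :
    (rankOneOp η ξ : H →L[ℂ] H) = InnerProductSpace.rankOne ℂ η ξ := rfl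

theorem CompactOp.ext_apply {a b : CompactOp H}
    (h : ∀ η : H, (a : H →L[ℂ] H) η = (b : H →L[ℂ] H) η) : a = b :=
  Subtype.ext (ContinuousLinearMap.ext h)

theorem mul_rankOneOp (a : CompactOp H) (η ξ : H) :
    a * rankOneOp η ξ = rankOneOp ((a : H →L[ℂ] H) η) ξ :=
  CompactOp.ext_apply fun _ => by simp

theorem rankOneOp_mul_rankOneOp (η ξ η' ξ' : H) :
    rankOneOp η ξ * rankOneOp η' ξ' = inner ℂ ξ η' • rankOneOp η ξ' :=
  CompactOp.ext_apply fun _ => by simp [smul_smul, mul_comm]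

theorem star_rankOneOp (η ξ : H) : star (rankOneOp η ξ) = rankOneOp ξ η :=
  Subtype.ext (by simp [ContinuousLinearMap.star_eq_adjoint])

theorem rankOneOp_add_left (η η' ξ : H) :
    rankOneOp (η + η') ξ = rankOneOp η ξ + rankOneOp η' ξ := Subtype.ext (by simp)

theorem rankOneOp_add_right (η ξ ξ' : H) :
    rankOneOp η (ξ + ξ') = rankOneOp η ξ + rankOneOp η ξ' := Subtype.ext (by simp)

theorem rankOneOp_smul_left (c : ℂ) (η ξ : H) : rankOneOp (c • η) ξ = c • rankOneOp η ξ :=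
  Subtype.ext (by simp)

theorem rankOneOp_smul_right (c : ℂ) (η ξ : H) :
    rankOneOp η (c • ξ) = star c • rankOneOp η ξ := Subtype.ext (by simp)

theorem rankOneOp_mul_mul_rankOneOp (a : CompactOp H) (η ξ η' ξ' : H) :
    rankOneOp η ξ * a * rankOneOp η' ξ' =
      inner ℂ ξ ((a : H →L[ℂ] H) η') • rankOneOp η ξ' := by
  rw [mul_assoc, mul_rankOneOp, rankOneOp_mul_rankOneOp]

theorem norm_rankOneOp (η ξ : H) : ‖rankOneOp η ξ‖ = ‖η‖ * ‖ξ‖ :=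
  InnerProductSpace.norm_rankOne η ξ

theorem CompactOp.nonneg_iff {a : CompactOp H} : 0 ≤ a ↔ (a : H →L[ℂ] H).IsPositive :=
  ContinuousLinearMap.nonneg_iff_isPositive _

theorem rankOneOp_self_nonneg (η : H) : 0 ≤ rankOneOp η η :=
  CompactOp.nonneg_iff.2 (InnerProductSpace.isPositive_rankOne_self η)

theorem isMinimalProjection_rankOneOp {ζ : H} (hζ : ‖ζ‖ = 1) :
    IsMinimalProjection (rankOneOp ζ ζ) where
  isStarProjection := ⟨by
    simp [IsIdempotentElem, rankOneOp_mul_rankOneOp, hζ], star_rankOneOp ζ ζ⟩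
  ne_zero h := by
    have := norm_rankOneOp ζ ζ
    rw [h, norm_zero, hζ] at this
    norm_num at this
  corner a := ⟨_, rankOneOp_mul_mul_rankOneOp a ζ ζ ζ ζ⟩

/-- The orthogonal projection onto a finite-dimensional subspace is compact. -/
def projOp (F : Submodule ℂ H) [FiniteDimensional ℂ F] : CompactOp H :=
  ⟨F.starProjection, (isCompactOperator_of_locallyCompactSpace_rng F.subtypeL).comp_clm
    F.orthogonalProjectionOnto⟩

theorem star_projOp (F : Submodule ℂ H) [FiniteDimensional ℂ F] : star (projOp F) = projOp F :=
  Subtype.ext (isSelfAdjoint_starProjection F)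

theorem norm_projOp_le (F : Submodule ℂ H) [FiniteDimensional ℂ F] : ‖projOp F‖ ≤ 1 :=
  Submodule.starProjection_norm_le F

theorem projOp_eq_sum (F : Submodule ℂ H) [FiniteDimensional ℂ F] :
    projOp F = ∑ i, rankOneOp (stdOrthonormalBasis ℂ F i : H) (stdOrthonormalBasis ℂ F i) := by
  apply Subtype.ext
  rw [AddSubmonoidClass.coe_finsetSum]
  exact (stdOrthonormalBasis ℂ F).starProjection_eq_sum_rankOne

/-- Compact operators are approximated by compressing their range to finite-dimensional
subspaces. -/
theorem exists_norm_sub_projOp_mul_le (a : CompactOp H) {ε : ℝ} (hε : 0 < ε) :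
    ∃ (F : Submodule ℂ H) (_ : FiniteDimensional ℂ F), ‖a - projOp F * a‖ ≤ ε := by
  have h1 : TotallyBounded ((a : H →L[ℂ] H) '' Metric.closedBall (0 : H) 1) :=
    ((IsCompactOperator.isCompact_closure_image_closedBall
      (f := ((a : H →L[ℂ] H) : H →ₗ[ℂ] H)) a.2 1).totallyBounded).subset subset_closure
  obtain ⟨t, -, htf, htc⟩ := Metric.finite_approx_of_totallyBounded h1 ε hε
  have := FiniteDimensional.span_of_finite ℂ htf
  refine ⟨Submodule.span ℂ t, this, ?_⟩
  refine ContinuousLinearMap.opNorm_le_of_unit_norm (𝕜 := ℂ) (f := (a : H →L[ℂ] H) -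
    (Submodule.span ℂ t).starProjection * (a : H →L[ℂ] H)) hε.le fun η hη => ?_
  have h2 := htc (Set.mem_image_of_mem _ (show η ∈ Metric.closedBall (0 : H) 1 by simp [hη]))
  simp only [Set.mem_iUnion] at h2
  obtain ⟨y, hy, hay⟩ := h2
  rw [Metric.mem_ball, dist_eq_norm] at hay
  -- The projection onto the span of the finite net is at least as close to aη as the net point y.
  refine le_trans ?_ hay.le
  have h3 := Submodule.starProjection_minimal (U := Submodule.span ℂ t) ((a : H →L[ℂ] H) η)
  change ‖(a : H →L[ℂ] H) η - (Submodule.span ℂ t).starProjection ((a : H →L[ℂ] H) η)‖ ≤ _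
  rw [h3]
  exact ciInf_le (f := fun x : Submodule.span ℂ t => ‖(a : H →L[ℂ] H) η - x‖)
    ⟨0, by rintro _ ⟨x, rfl⟩; exact norm_nonneg _⟩ ⟨y, Submodule.subset_span hy⟩

theorem dense_span_rankOneOp :
    Dense (Submodule.span ℂ {a : CompactOp H | ∃ η ξ, a = rankOneOp η ξ} : Set (CompactOp H)) := by
  intro a
  rw [Metric.mem_closure_iff]
  intro ε hε
  obtain ⟨F, _, hF⟩ := exists_norm_sub_projOp_mul_le a (half_pos hε)
  refine ⟨projOp F * a, ?_, by rw [dist_eq_norm]; linarith⟩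
  rw [projOp_eq_sum, Finset.sum_mul]
  -- With p the projection onto F and eᵢ its basis, p a = ∑ |eᵢ⟩⟨a⋆eᵢ|.
  refine Submodule.sum_mem _ fun i _ => Submodule.subset_span
    ⟨stdOrthonormalBasis ℂ F i, star (a : H →L[ℂ] H) (stdOrthonormalBasis ℂ F i), ?_⟩
  refine CompactOp.ext_apply fun η => ?_
  simp [ContinuousLinearMap.star_eq_adjoint, ContinuousLinearMap.adjoint_inner_left]

/-- Continuous functionals on `𝕂(H)` that agree on rank-one operators are equal. -/
theorem functional_ext {τ σ : CompactOp H →L[ℂ] ℂ}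
    (h : ∀ η ξ, τ (rankOneOp η ξ) = σ (rankOneOp η ξ)) : τ = σ := by
  refine ContinuousLinearMap.ext_on dense_span_rankOneOp ?_
  rintro _ ⟨η, ξ, rfl⟩
  exact h η ξ

/-- Positivity of a continuous functional on `𝕂(H)` can be tested on rank-one operators. -/
theorem isPositiveFunctional_of_rankOneOp {τ : CompactOp H →L[ℂ] ℂ}
    (h : ∀ η, 0 ≤ τ (rankOneOp η η)) : IsPositiveFunctional τ := by
  intro a ha
  have hpos := CompactOp.nonneg_iff.1 ha
  have hcl : IsClosed {b : CompactOp H | 0 ≤ τ b} :=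
    isClosed_le continuous_const τ.continuous
  suffices a ∈ closure {b : CompactOp H | 0 ≤ τ b} by rwa [hcl.closure_eq] at this
  rw [Metric.mem_closure_iff]
  intro ε hε
  obtain ⟨F, _, hF⟩ := exists_norm_sub_projOp_mul_le a (show 0 < ε / 4 by positivity)
  have hsa : star a = a := Subtype.ext hpos.isSelfAdjoint
  -- The compression p a p is a positive operator on a finite-dimensional space, hence a finite sum
  -- of operators |u⟩⟨u|, and it is close to a.
  refine ⟨projOp F * a * projOp F, ?_, ?_⟩
  · obtain ⟨m, u, hu⟩ := ContinuousLinearMap.isPositive_iff_eq_sum_rankOne.1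
      (hpos.orthogonalProjectionOnto_comp F)
    have : projOp F * a * projOp F = ∑ i, rankOneOp (u i : H) (u i) := by
      refine CompactOp.ext_apply fun η => ?_
      have := congrArg (fun T : F →L[ℂ] F => (T (F.orthogonalProjectionOnto η) : H)) hu
      rw [AddSubmonoidClass.coe_finsetSum]
      simp only [sum_apply, AddSubmonoidClass.coe_finsetSum] at this ⊢
      refine Eq.trans ?_ (this.trans (Finset.sum_congr rfl fun i _ => ?_))
      · rfl
      · simp only [InnerProductSpace.rankOne_apply, coe_rankOneOp, Submodule.coe_smul,
          Submodule.inner_orthogonalProjectionOnto_eq_of_mem_left]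
    rw [Set.mem_ofPred_eq, this, map_sum]
    exact Finset.sum_nonneg fun i _ => h _
  · rw [dist_eq_norm]
    have h2 : ‖a - a * projOp F‖ ≤ ε / 4 := by
      rw [← norm_star, star_sub, star_mul, star_projOp, hsa]; exact hF
    have h3 : ‖(a - projOp F * a) * projOp F‖ ≤ ε / 4 := by
      refine (norm_mul_le _ _).trans ?_
      nlinarith [norm_projOp_le F, norm_nonneg (projOp F), norm_nonneg (a - projOp F * a)]
    have h4 : a - projOp F * a * projOp F = (a - a * projOp F) + (a - projOp F * a) * projOp F := by
      rw [sub_mul]; abel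
    rw [h4]
    exact lt_of_le_of_lt (norm_add_le _ _) (by linarith)

end RankOne

/-! ### Pure states of `𝕂(H)` are vector states -/

section VectorState

variable {H : Type*} [NormedAddCommGroup H] [InnerProductSpace ℂ H] [CompleteSpace H]

/-- The functional `a ↦ ⟨ζ, a ζ⟩` on `𝕂(H)`. -/
def vectorFunctional (ζ : H) : CompactOp H →L[ℂ] ℂ :=
  LinearMap.mkContinuous
    { toFun a := inner ℂ ζ ((a : H →L[ℂ] H) ζ)
      map_add' a b := by simp
      map_smul' c a := by simp } (‖ζ‖ ^ 2) fun a => by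
    refine (norm_inner_le_norm _ _).trans ?_
    have : ‖(a : H →L[ℂ] H) ζ‖ ≤ ‖a‖ * ‖ζ‖ := (a : H →L[ℂ] H).le_opNorm ζ
    nlinarith [norm_nonneg ζ]

theorem vectorFunctional_apply (ζ : H) (a : CompactOp H) :
    vectorFunctional ζ a = inner ℂ ζ ((a : H →L[ℂ] H) ζ) := rfl

theorem vectorFunctional_rankOneOp (ζ η ξ : H) :
    vectorFunctional ζ (rankOneOp η ξ) = inner ℂ ξ ζ * inner ℂ ζ η := by
  simp [vectorFunctional_apply]

theorem norm_inner_self {E : Type*} [NormedAddCommGroup E] [InnerProductSpace ℂ E] (ζ : E) :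
    ‖(inner ℂ ζ ζ : ℂ)‖ = ‖ζ‖ * ‖ζ‖ := by
  rw [inner_self_eq_norm_sq_to_K, norm_pow, RCLike.norm_ofReal, abs_norm, sq]

theorem norm_vectorFunctional (ζ : H) : ‖vectorFunctional ζ‖ = ‖ζ‖ ^ 2 := by
  refine le_antisymm (LinearMap.mkContinuous_norm_le _ (by positivity) _) ?_
  rcases eq_or_ne ζ 0 with rfl | h
  · rw [norm_zero, zero_pow two_ne_zero]
    exact ContinuousLinearMap.opNorm_nonneg _
  · have h1 := (vectorFunctional ζ).le_opNorm (rankOneOp ζ ζ)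
    rw [vectorFunctional_rankOneOp, norm_rankOneOp, norm_mul, norm_inner_self] at h1
    have h2 : 0 < ‖ζ‖ * ‖ζ‖ := by have := norm_pos_iff.2 h; positivity
    rw [sq]
    exact le_of_mul_le_mul_right h1 h2

theorem vectorFunctional_positive (ζ : H) : IsPositiveFunctional (vectorFunctional ζ) :=
  fun _ ha => (CompactOp.nonneg_iff.1 ha).inner_nonneg_right ζ

/-- The semi-inner product `⟨ξ, η⟩_ρ = ρ(|η⟩⟨ξ|)` of a positive functional `ρ` on `𝕂(H)`. -/
abbrev rankOneCore {ρ : CompactOp H →L[ℂ] ℂ} (hρ : IsPositiveFunctional ρ) :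
    PreInnerProductSpace.Core ℂ H where
  inner ξ η := ρ (rankOneOp η ξ)
  conj_inner_symm ξ η := by
    -- Polarization: positivity makes the diagonal values real, and the values at ξ + η and ξ + iη
    -- then force Hermitian symmetry.
    have key : ∀ ζ : H, (ρ (rankOneOp ζ ζ)).im = 0 := fun ζ =>
      ((Complex.nonneg_iff.1 (hρ _ (rankOneOp_self_nonneg ζ))).2).symm
    have hx := key ξ
    have hy := key η
    have h1 := key (ξ + η)
    have h2 := key (ξ + Complex.I • η)
    simp only [rankOneOp_add_right, rankOneOp_add_left, rankOneOp_smul_right, rankOneOp_smul_left,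
      map_add, map_smul, smul_eq_mul, Complex.add_im, Complex.star_def, Complex.conj_I,
      Complex.mul_im, Complex.add_re, Complex.mul_re, Complex.neg_re, Complex.neg_im, Complex.I_re,
      Complex.I_im, hx, hy] at h1 h2
    apply Complex.ext
    · simp only [Complex.conj_re]
      linarith
    · simp only [Complex.conj_im]
      linarith
  re_inner_nonneg ξ := (Complex.nonneg_iff.1 (hρ _ (rankOneOp_self_nonneg ξ))).1
  add_left ξ ξ' η := by rw [rankOneOp_add_right, map_add]
  smul_left ξ η c := by rw [rankOneOp_smul_right, map_smul]; rfl

/-- Cauchy–Schwarz for the semi-inner product `rankOneCore`. -/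
theorem norm_functional_rankOneOp_sq_le {ρ : CompactOp H →L[ℂ] ℂ} (hρ : IsPositiveFunctional ρ)
    (η ξ : H) :
    ‖ρ (rankOneOp η ξ)‖ ^ 2 ≤ (ρ (rankOneOp ξ ξ)).re * (ρ (rankOneOp η η)).re := by
  have h1 := InnerProductSpace.Core.inner_mul_inner_self_le (c := rankOneCore hρ) ξ η
  have h2 := InnerProductSpace.Core.norm_inner_symm (c := rankOneCore hρ) η ξ
  rw [h2] at h1
  rw [sq]
  exact h1

theorem functional_rankOneOp_eq_ofReal {ρ : CompactOp H →L[ℂ] ℂ} (hρ : IsPositiveFunctional ρ)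
    (η : H) : ρ (rankOneOp η η) = ((ρ (rankOneOp η η)).re : ℂ) :=
  Complex.eq_re_of_ofReal_le (hρ _ (rankOneOp_self_nonneg η))

/-- Unit vectors define pure states of `𝕂(H)`. -/
def vectorState (ζ : H) (hζ : ‖ζ‖ = 1) : PureState (CompactOp H) where
  toFunctional := vectorFunctional ζ
  positive := vectorFunctional_positive ζ
  norm_eq_one := by rw [norm_vectorFunctional, hζ, one_pow]
  pure ρ hρ hτρ := by
    -- Domination makes ρ(|η⟩⟨η|) vanish for η ⊥ ζ. By Cauchy–Schwarz ρ then kills |η⟩⟨ξ| as soon as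
    -- one of η, ξ is orthogonal to ζ, so only the components along ζ count.
    have hle : ∀ η, (ρ (rankOneOp η η)).re ≤ ‖inner ℂ ζ η‖ ^ 2 := fun η => by
      have := (Complex.nonneg_iff.1 (hτρ _ (rankOneOp_self_nonneg η))).1
      rw [sub_apply, vectorFunctional_rankOneOp, ← inner_conj_symm, Complex.conj_mul',
        Complex.sub_re, ← Complex.ofReal_pow, Complex.ofReal_re] at this
      linarith
    have hz1 : ∀ η ξ, inner ℂ ζ η = 0 → ρ (rankOneOp η ξ) = 0 := fun η ξ h => by
      have h1 := norm_functional_rankOneOp_sq_le hρ η ξ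
      have h2 : (ρ (rankOneOp η η)).re = 0 := le_antisymm (by simpa [h] using hle η)
        (Complex.nonneg_iff.1 (hρ _ (rankOneOp_self_nonneg η))).1
      rw [h2, mul_zero] at h1
      simpa using le_antisymm h1 (sq_nonneg _)
    have hz2 : ∀ η ξ, inner ℂ ζ ξ = 0 → ρ (rankOneOp η ξ) = 0 := fun η ξ h => by
      have h1 := norm_functional_rankOneOp_sq_le hρ η ξ
      have h2 : (ρ (rankOneOp ξ ξ)).re = 0 := le_antisymm (by simpa [h] using hle ξ)
        (Complex.nonneg_iff.1 (hρ _ (rankOneOp_self_nonneg ξ))).1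
      rw [h2, zero_mul] at h1
      simpa using le_antisymm h1 (sq_nonneg _)
    refine ⟨(ρ (rankOneOp ζ ζ)).re, (Complex.nonneg_iff.1 (hρ _ (rankOneOp_self_nonneg ζ))).1,
      by simpa [hζ] using hle ζ, functional_ext fun η ξ => ?_⟩
    have hd : ∀ η : H, inner ℂ ζ (η - inner ℂ ζ η • ζ) = 0 := fun η => by
      simp [hζ]
    have e1 : ρ (rankOneOp η ξ) = inner ℂ ζ η * ρ (rankOneOp ζ ξ) := by
      have := hz1 (η - inner ℂ ζ η • ζ) ξ (hd η)
      have h3 := rankOneOp_add_left (η - inner ℂ ζ η • ζ) (inner ℂ ζ η • ζ) ξ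
      rw [sub_add_cancel] at h3
      rw [h3, map_add, this, zero_add, rankOneOp_smul_left, map_smul, smul_eq_mul]
    have e2 : ρ (rankOneOp ζ ξ) = inner ℂ ξ ζ * ρ (rankOneOp ζ ζ) := by
      have := hz2 ζ (ξ - inner ℂ ζ ξ • ζ) (hd ξ)
      have h3 := rankOneOp_add_right ζ (ξ - inner ℂ ζ ξ • ζ) (inner ℂ ζ ξ • ζ)
      rw [sub_add_cancel] at h3
      rw [h3, map_add, this, zero_add, rankOneOp_smul_right, map_smul, smul_eq_mul]
      simp
    rw [e1, e2, functional_rankOneOp_eq_ofReal hρ, smul_apply,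
      vectorFunctional_rankOneOp, smul_eq_mul, Complex.ofReal_re]
    ring

theorem PureState.ext_functional {A : Type*} [NonUnitalCStarAlgebra A] [PartialOrder A]
    {τ σ : PureState A} (h : τ.toFunctional = σ.toFunctional) : τ = σ := by
  cases τ; cases σ; cases h; rfl

/-- Every pure state of `𝕂(H)` is a vector state. -/
theorem exists_eq_vectorState (τ : PureState (CompactOp H)) :
    ∃ (ζ : H) (hζ : ‖ζ‖ = 1), τ = vectorState ζ hζ := by
  have hτ := τ.positive
  have hne : τ.toFunctional ≠ 0 := fun h => by simpa [h] using τ.norm_eq_one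
  obtain ⟨η, v, hv⟩ : ∃ η v : H, τ.toFunctional (rankOneOp η v) ≠ 0 := by
    by_contra! h
    exact hne (functional_ext fun η ξ => by rw [h]; rfl)
  set c := (τ.toFunctional (rankOneOp v v)).re with hc
  have hcnn : 0 ≤ c := (Complex.nonneg_iff.1 (hτ _ (rankOneOp_self_nonneg v))).1
  have hcpos : 0 < c := by
    refine lt_of_le_of_ne hcnn fun h0 => hv ?_
    have h1 := norm_functional_rankOneOp_sq_le hτ η v
    rw [← hc, ← h0, zero_mul] at h1
    simpa using le_antisymm h1 (sq_nonneg _)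
  let f : H →L[ℂ] ℂ := LinearMap.mkContinuous
    { toFun η := τ.toFunctional (rankOneOp η v)
      map_add' η η' := by rw [rankOneOp_add_left, map_add]
      map_smul' c η := by rw [rankOneOp_smul_left, map_smul]; rfl } ‖v‖ fun η => by
    have := τ.toFunctional.le_opNorm (rankOneOp η v)
    rw [τ.norm_eq_one, norm_rankOneOp, one_mul, mul_comm] at this
    exact this
  -- Riesz vector of η ↦ τ(|η⟩⟨v|). Cauchy–Schwarz reads |⟨w₀, η⟩|² ≤ c τ(|η⟩⟨η|), so after division
  -- by √c the functional of w is dominated by τ. Purity then makes it a multiple tτ, and rescaling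
  -- by 1/√t recovers τ.
  let w₀ : H := (InnerProductSpace.toDual ℂ H).symm f
  have hw₀ : ∀ η, inner ℂ w₀ η = τ.toFunctional (rankOneOp η v) := fun η =>
    InnerProductSpace.toDual_symm_apply
  have hw₀ne : w₀ ≠ 0 := fun h => hv (by rw [← hw₀, h, inner_zero_left])
  let w : H := ((√c)⁻¹ : ℂ) • w₀
  have hwne : w ≠ 0 := smul_ne_zero (by simpa using (Real.sqrt_pos.2 hcpos).ne') hw₀ne
  have hdom : IsPositiveFunctional (τ.toFunctional - vectorFunctional w) := by
    refine isPositiveFunctional_of_rankOneOp fun η => ?_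
    have h1 := norm_functional_rankOneOp_sq_le hτ η v
    rw [← hw₀, ← hc] at h1
    have h2 : vectorFunctional w (rankOneOp η η) = ((c⁻¹ * ‖inner ℂ w₀ η‖ ^ 2 : ℝ) : ℂ) := by
      rw [vectorFunctional_rankOneOp, ← inner_conj_symm, Complex.conj_mul']
      simp only [w, inner_smul_left, norm_mul]
      have : ‖(starRingEnd ℂ) ((√c : ℂ)⁻¹)‖ ^ 2 = c⁻¹ := by
        simp [abs_of_nonneg, Real.sq_sqrt hcnn]
      rw [← this]
      push_cast
      ring
    rw [sub_apply, functional_rankOneOp_eq_ofReal hτ, h2, ← Complex.ofReal_sub]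
    refine Complex.zero_le_real.2 (sub_nonneg.2 ?_)
    rw [inv_mul_le_iff₀ hcpos]
    exact h1
  obtain ⟨t, ht0, ht1, ht⟩ := τ.pure _ (vectorFunctional_positive w) hdom
  have htpos : 0 < t := by
    refine lt_of_le_of_ne ht0 fun h0 => ?_
    have := vectorFunctional_rankOneOp w w w
    rw [ht, ← h0, smul_apply, Complex.ofReal_zero, smul_eq_mul, zero_mul, zero_eq_mul_self,
      inner_self_eq_zero] at this
    exact hwne this
  have hfun : τ.toFunctional = vectorFunctional (((√t)⁻¹ : ℂ) • w) := by
    refine functional_ext fun η ξ => ?_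
    have h1 := vectorFunctional_rankOneOp w η ξ
    rw [ht, smul_apply, smul_eq_mul] at h1
    rw [vectorFunctional_rankOneOp, inner_smul_left, inner_smul_right]
    have h2 : ((√t : ℂ)⁻¹) * (starRingEnd ℂ) ((√t : ℂ)⁻¹) * t = 1 := by
      have : (√t : ℂ) * (√t : ℂ) = t := by rw [← Complex.ofReal_mul, Real.mul_self_sqrt ht0]
      have h3 : (√t : ℂ) ≠ 0 := by simpa using (Real.sqrt_pos.2 htpos).ne'
      rw [map_inv₀, Complex.conj_ofReal, ← this]
      field_simp
    linear_combination (-τ.toFunctional (rankOneOp η ξ)) * h2 +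
      ((√t : ℂ)⁻¹) * (starRingEnd ℂ) ((√t : ℂ)⁻¹) * h1
  have hnorm : ‖((√t)⁻¹ : ℂ) • w‖ = 1 := by
    have := τ.norm_eq_one
    rw [hfun, norm_vectorFunctional] at this
    exact (pow_eq_one_iff_of_nonneg (norm_nonneg _) two_ne_zero).1 this
  exact ⟨_, hnorm, PureState.ext_functional hfun⟩

end VectorState

/-! ### Right Hilbert modules: consequences of the definition -/

section Module

variable {A X : Type*} [NonUnitalCStarAlgebra A] [PartialOrder A]
  [NormedAddCommGroup X] [NormedSpace ℂ X]

/-- Nondegeneracy of the inner product. The structure assumes a bare scalar action, so linearity of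
projections and the module axioms below are all read off from the inner product this way. -/
theorem eq_of_inner_right [SMul A X] [CStarModule A X] {x y : X}
    (h : ∀ z : X, inner A z x = inner A z y) : x = y := by
  rw [← sub_eq_zero, ← CStarModule.inner_self (A := A), CStarModule.inner_sub_right, h, sub_self]

theorem IsProjection.map_add [SMul A X] [CStarModule A X] {P : X → X} (hP : IsProjection A P)
    (x y : X) : P (x + y) = P x + P y :=
  eq_of_inner_right (A := A) fun z => by
    rw [← hP.self_adjoint, CStarModule.inner_add_right, CStarModule.inner_add_right,
      hP.self_adjoint, hP.self_adjoint]

theorem IsProjection.map_smul [SMul A X] [CStarModule A X] {P : X → X} (hP : IsProjection A P)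
    (c : ℂ) (x : X) : P (c • x) = c • P x :=
  eq_of_inner_right (A := A) fun z => by
    rw [← hP.self_adjoint, CStarModule.inner_smul_right_complex,
      CStarModule.inner_smul_right_complex, hP.self_adjoint]

variable [SMul Aᵐᵒᵖ X] [CStarModule Aᵐᵒᵖ X]

theorem rinner_op_smul_left (x y : X) (a : A) :
    rinner A (MulOpposite.op a • x) y = star a * rinner A x y := by
  rw [← star_rinner, rinner_op_smul_right, star_mul, star_rinner]

theorem rinner_sub_right (x y z : X) : rinner A x (y - z) = rinner A x y - rinner A x z := by
  simp [rinner]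

theorem rinner_sub_left (x y z : X) : rinner A (x - y) z = rinner A x z - rinner A y z := by
  simp [rinner]

theorem eq_of_rinner_right {x y : X} (h : ∀ z : X, rinner A z x = rinner A z y) : x = y :=
  eq_of_inner_right (A := Aᵐᵒᵖ) fun z => MulOpposite.unop_injective (h z)

theorem op_mul_smul (a b : A) (x : X) :
    MulOpposite.op (a * b) • x = MulOpposite.op b • MulOpposite.op a • x :=
  eq_of_rinner_right (A := A) fun z => by simp only [rinner_op_smul_right, mul_assoc]

theorem op_add_smul (a b : A) (x : X) :
    MulOpposite.op (a + b) • x = MulOpposite.op a • x + MulOpposite.op b • x :=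
  eq_of_rinner_right (A := A) fun z => by
    simp only [rinner_op_smul_right, rinner_add_right, mul_add]

theorem op_smul_smul (c : ℂ) (a : A) (x : X) :
    MulOpposite.op (c • a) • x = c • MulOpposite.op a • x :=
  eq_of_rinner_right (A := A) fun z => by
    simp only [rinner_op_smul_right, rinner_smul_right, mul_smul_comm]

theorem op_smul_add (a : A) (x y : X) :
    MulOpposite.op a • (x + y) = MulOpposite.op a • x + MulOpposite.op a • y :=
  eq_of_rinner_right (A := A) fun z => by
    simp only [rinner_op_smul_right, rinner_add_right, add_mul]

theorem op_smul_complex_smul (a : A) (c : ℂ) (x : X) :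
    MulOpposite.op a • c • x = c • MulOpposite.op a • x :=
  eq_of_rinner_right (A := A) fun z => by
    simp only [rinner_op_smul_right, rinner_smul_right, smul_mul_assoc]

variable (A) in
theorem norm_sq_eq_norm_rinner (x : X) : ‖x‖ ^ 2 = ‖rinner A x x‖ :=
  CStarModule.norm_sq_eq Aᵐᵒᵖ

/-- The coefficient algebra acts linearly on a fixed vector. -/
def orbitMap (x : X) : A →ₗ[ℂ] X where
  toFun a := MulOpposite.op a • x
  map_add' a b := op_add_smul a b x
  map_smul' c a := op_smul_smul c a x

theorem orbitMap_apply (x : X) (a : A) : orbitMap x a = MulOpposite.op a • x := rfl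

variable (τ : PureState A)

theorem toLocalization_add (x y : X) :
    toLocalization τ (x + y) = toLocalization τ x + toLocalization τ y :=
  UniformSpace.Completion.coe_add (α := PreLocalization τ X) x y

theorem toLocalization_smul (c : ℂ) (x : X) :
    toLocalization τ (c • x) = c • toLocalization τ x :=
  UniformSpace.Completion.coe_smul (X := PreLocalization τ X) c x

variable (X) in
/-- The canonical map to the localization, as a linear map. -/
def toLocalizationₗ : X →ₗ[ℂ] Localization τ X where
  toFun := toLocalization τ
  map_add' := toLocalization_add τ
  map_smul' := toLocalization_smul τ

theorem denseRange_toLocalization : DenseRange (toLocalization τ : X → Localization τ X) :=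
  UniformSpace.Completion.denseRange_coe (α := PreLocalization τ X)

end Module

/-! ### Modules over `𝕂(H)` as spaces of operators -/

section Represent

variable {H : Type*} [NormedAddCommGroup H] [InnerProductSpace ℂ H] [CompleteSpace H]
  {X : Type*} [NormedAddCommGroup X] [NormedSpace ℂ X]
  [SMul (CompactOp H)ᵐᵒᵖ X] [CStarModule (CompactOp H)ᵐᵒᵖ X]

theorem exists_norm_sub_projOp_smul_le (x : X) {ε : ℝ} (hε : 0 < ε) :
    ∃ (F : Submodule ℂ H) (_ : FiniteDimensional ℂ F),
      ‖x - MulOpposite.op (projOp F) • x‖ ≤ ε := by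
  obtain ⟨F, hF, h⟩ := exists_norm_sub_projOp_mul_le (rinner (CompactOp H) x x)
    (show 0 < ε ^ 2 / 2 by positivity)
  refine ⟨F, hF, le_of_sq_le_sq ?_ hε.le⟩
  rw [norm_sq_eq_norm_rinner (CompactOp H), rinner_sub_left, rinner_sub_right, rinner_sub_right,
    rinner_op_smul_left, rinner_op_smul_left, rinner_op_smul_right, star_projOp]
  set r := rinner (CompactOp H) x x
  -- ‖x - xp‖² is the norm of (1 - p) r (1 - p), split here into two terms of norm at most ε²/2
  -- each.
  have e : r - r * projOp F - (projOp F * r - projOp F * (r * projOp F)) =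
      (r - projOp F * r) - (r - projOp F * r) * projOp F := by
    rw [sub_mul, mul_assoc]; abel
  rw [e]
  refine (norm_sub_le _ _).trans ?_
  have h3 : ‖(r - projOp F * r) * projOp F‖ ≤ ε ^ 2 / 2 := by
    refine (norm_mul_le _ _).trans ?_
    nlinarith [norm_projOp_le F, norm_nonneg (projOp F), norm_nonneg (r - projOp F * r)]
  linarith

/-- A Hilbert space `K` with a map from `X` that realizes it as the localization of `X` at the
vector state of the unit vector `ζ`. -/
structure VectorLocalization (ζ : H) (X K : Type*) [NormedAddCommGroup X] [NormedSpace ℂ X]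
    [SMul (CompactOp H)ᵐᵒᵖ X] [CStarModule (CompactOp H)ᵐᵒᵖ X] [NormedAddCommGroup K]
    [InnerProductSpace ℂ K] where
  toLin : X →ₗ[ℂ] K
  norm_vec : ‖ζ‖ = 1
  inner_map : ∀ x y, inner ℂ (toLin x) (toLin y) =
    inner ℂ ζ ((rinner (CompactOp H) x y : H →L[ℂ] H) ζ)
  dense : DenseRange toLin

namespace VectorLocalization

variable {ζ : H} {K : Type*} [NormedAddCommGroup K] [InnerProductSpace ℂ K]
  (L : VectorLocalization ζ X K)

theorem inner_op_smul (x y : X) (a b : CompactOp H) :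
    inner ℂ (L.toLin (MulOpposite.op a • x)) (L.toLin (MulOpposite.op b • y)) =
      inner ℂ ((a : H →L[ℂ] H) ζ)
        ((rinner (CompactOp H) x y : H →L[ℂ] H) ((b : H →L[ℂ] H) ζ)) := by
  rw [L.inner_map, rinner_op_smul_left, rinner_op_smul_right]
  exact ContinuousLinearMap.adjoint_inner_right (a : H →L[ℂ] H) _ _

theorem rankOneOp_apply_self (L : VectorLocalization ζ X K) (η : H) :
    (rankOneOp η ζ : H →L[ℂ] H) ζ = η := by
  simp [L.norm_vec]

theorem inner_rankOneOp_smul (x y : X) (η η' : H) :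
    inner ℂ (L.toLin (MulOpposite.op (rankOneOp η ζ) • x))
        (L.toLin (MulOpposite.op (rankOneOp η' ζ) • y)) =
      inner ℂ η ((rinner (CompactOp H) x y : H →L[ℂ] H) η') := by
  rw [inner_op_smul, L.rankOneOp_apply_self, L.rankOneOp_apply_self]

/-- A vector `x` acts as the operator `η ↦ x |η⟩⟨ζ| + N_τ` from `H` to the localization. -/
def toOpₗ : X →ₗ[ℂ] (H →L[ℂ] K) where
  toFun x := LinearMap.mkContinuous
    { toFun η := L.toLin (MulOpposite.op (rankOneOp η ζ) • x)
      map_add' η η' := by rw [rankOneOp_add_left, op_add_smul, map_add]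
      map_smul' c η := by
        rw [rankOneOp_smul_left, op_smul_smul, map_smul, RingHom.id_apply] } ‖x‖ fun η => by
    refine le_of_sq_le_sq ?_ (by positivity)
    rw [← inner_self_eq_norm_sq (𝕜 := ℂ)]
    change RCLike.re (inner ℂ (L.toLin _) (L.toLin _)) ≤ _
    rw [inner_rankOneOp_smul, mul_pow, norm_sq_eq_norm_rinner (CompactOp H)]
    refine (RCLike.re_le_norm _).trans ((norm_inner_le_norm _ _).trans ?_)
    have : ‖(rinner (CompactOp H) x x : H →L[ℂ] H) η‖ ≤ ‖rinner (CompactOp H) x x‖ * ‖η‖ :=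
      ContinuousLinearMap.le_opNorm _ _
    nlinarith [norm_nonneg η]
  map_add' x y := ContinuousLinearMap.ext fun η =>
    (congrArg L.toLin (op_smul_add _ x y)).trans (map_add _ _ _)
  map_smul' c x := ContinuousLinearMap.ext fun η =>
    (congrArg L.toLin (op_smul_complex_smul _ c x)).trans (map_smul _ _ _)

variable [CompleteSpace K]

/-- The isometric representation of `X` by operators from `H` to the localization. -/
def toOp : X →ₗᵢ[ℂ] (H →L[ℂ] K) where
  toLinearMap := L.toOpₗ
  norm_map' x := by
    -- Once x⋆x = ⟨x, x⟩ as operators on H, the C⋆-identity gives isometry.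
    have h : ContinuousLinearMap.adjoint (L.toOpₗ x) ∘L L.toOpₗ x =
        (rinner (CompactOp H) x x : H →L[ℂ] H) := by
      refine ContinuousLinearMap.ext fun η => ext_inner_left ℂ fun ξ => ?_
      rw [ContinuousLinearMap.comp_apply, ContinuousLinearMap.adjoint_inner_right]
      exact L.inner_rankOneOp_smul x x ξ η
    rw [← sq_eq_sq₀ (norm_nonneg _) (norm_nonneg _), norm_sq_eq_norm_rinner (CompactOp H) x, sq,
      ← ContinuousLinearMap.norm_adjoint_comp_self, h]
    rfl

theorem toOp_apply (x : X) (η : H) :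
    L.toOp x η = L.toLin (MulOpposite.op (rankOneOp η ζ) • x) := rfl

theorem inner_toOp (x y : X) (η ξ : H) : inner ℂ (L.toOp x η) (L.toOp y ξ) =
    inner ℂ η ((rinner (CompactOp H) x y : H →L[ℂ] H) ξ) :=
  L.inner_rankOneOp_smul x y η ξ

theorem toOp_op_smul (a : CompactOp H) (x : X) :
    L.toOp (MulOpposite.op a • x) = L.toOp x ∘L (a : H →L[ℂ] H) :=
  ContinuousLinearMap.ext fun η => by
    rw [toOp_apply, ← op_mul_smul, mul_rankOneOp]
    rfl

/-- The vectors x and x |ζ⟩⟨ζ| differ by a vector of length zero for the state of ζ. -/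
theorem toOp_apply_self (x : X) : L.toOp x ζ = L.toLin x := by
  rw [toOp_apply, ← sub_eq_zero, ← map_sub, ← inner_self_eq_zero (𝕜 := ℂ), L.inner_map]
  rw [rinner_sub_left, rinner_sub_right, rinner_sub_right, rinner_op_smul_left,
    rinner_op_smul_left, rinner_op_smul_right, star_rankOneOp, ← mul_assoc]
  simp [L.norm_vec]

theorem norm_toLin_le (x : X) : ‖L.toLin x‖ ≤ ‖x‖ := by
  rw [← toOp_apply_self]
  simpa [L.norm_vec] using (L.toOp x).le_opNorm ζ

theorem toOp_rankOneOp_smul (x : X) (η ξ : H) :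
    L.toOp (MulOpposite.op (rankOneOp η ξ) • x) = InnerProductSpace.rankOne ℂ (L.toOp x η) ξ := by
  rw [toOp_op_smul]
  exact ContinuousLinearMap.ext fun η => by simp

variable [CompleteSpace X]

theorem isClosed_range_toOp : IsClosed (Set.range L.toOp) :=
  L.toOp.isometry.isClosedEmbedding.isClosed_range

/-- If k = [x], then x |ζ⟩⟨ξ| is represented by |k⟩⟨ξ|. Such k are dense and the range is closed. -/
theorem exists_toOp_eq_rankOne (k : K) (ξ : H) :
    ∃ x, L.toOp x = InnerProductSpace.rankOne ℂ k ξ := by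
  have hcl : IsClosed {k : K | InnerProductSpace.rankOne ℂ k ξ ∈ Set.range L.toOp} :=
    L.isClosed_range_toOp.preimage (by fun_prop)
  refine L.dense.induction_on k hcl fun x => ?_
  exact ⟨MulOpposite.op (rankOneOp ζ ξ) • x, by rw [toOp_rankOneOp_smul, toOp_apply_self]⟩

/-- For a finite-rank projection p, T x p is a finite sum of rank-one operators, all of which lie in
the range; and xp approximates x. This is what lifts operators from K to X. -/
theorem exists_toOp_eq_comp (T : K →L[ℂ] K) (x : X) : ∃ y, L.toOp y = T ∘L L.toOp x := by
  have hcl : IsClosed {x : X | T ∘L L.toOp x ∈ Set.range L.toOp} :=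
    L.isClosed_range_toOp.preimage
      ((ContinuousLinearMap.compL ℂ H K K T).continuous.comp L.toOp.continuous)
  suffices x ∈ closure {x : X | T ∘L L.toOp x ∈ Set.range L.toOp} by
    rwa [hcl.closure_eq] at this
  rw [Metric.mem_closure_iff]
  intro ε hε
  obtain ⟨F, _, hF⟩ := exists_norm_sub_projOp_smul_le (H := H) x (half_pos hε)
  refine ⟨MulOpposite.op (projOp F) • x, ?_, by rw [dist_eq_norm]; linarith⟩
  choose y hy using fun i => L.exists_toOp_eq_rankOne
    (T (L.toOp x (stdOrthonormalBasis ℂ F i))) (stdOrthonormalBasis ℂ F i : H)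
  refine ⟨∑ i, y i, ?_⟩
  rw [map_sum, projOp_eq_sum, ← orbitMap_apply, map_sum, map_sum,
    ContinuousLinearMap.comp_finsetSum]
  refine Finset.sum_congr rfl fun i _ => ?_
  rw [hy, orbitMap_apply, toOp_rankOneOp_smul, InnerProductSpace.comp_rankOne]

end VectorLocalization

/-- The localization at a vector state. -/
def vectorLocalization (X : Type*) [NormedAddCommGroup X] [NormedSpace ℂ X]
    [SMul (CompactOp H)ᵐᵒᵖ X] [CStarModule (CompactOp H)ᵐᵒᵖ X] (ζ : H) (hζ : ‖ζ‖ = 1) :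
    VectorLocalization ζ X (Localization (vectorState ζ hζ) X) where
  toLin := toLocalizationₗ X (vectorState ζ hζ)
  norm_vec := hζ
  inner_map x y := inner_toLocalization _ _ x y
  dense := denseRange_toLocalization _

end Represent

/-! ### Transfer of projection decompositions -/

section HilbertSpace

variable {K : Type*} [NormedAddCommGroup K] [InnerProductSpace ℂ K]

theorem IsProjection.norm_le {Q : K → K} (hQ : IsProjection ℂ Q) (k : K) : ‖Q k‖ ≤ ‖k‖ := by
  have h1 : inner ℂ (Q k) (Q k) = inner ℂ k (Q k) := by
    have := hQ.self_adjoint k (Q k)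
    rwa [hQ.idempotent] at this
  have h2 : ‖Q k‖ * ‖Q k‖ ≤ ‖k‖ * ‖Q k‖ := by
    rw [← norm_inner_self, h1]
    exact norm_inner_le_norm _ _
  rcases (norm_nonneg (Q k)).eq_or_lt with h | h
  · rw [← h]; exact norm_nonneg _
  · exact le_of_mul_le_mul_right h2 h

/-- A projection on a Hilbert space as a continuous linear map. -/
def IsProjection.toCLM {Q : K → K} (hQ : IsProjection ℂ Q) : K →L[ℂ] K :=
  LinearMap.mkContinuous
    { toFun := Q
      map_add' := hQ.map_add
      map_smul' := hQ.map_smul } 1 fun k => by rw [one_mul]; exact hQ.norm_le k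

theorem IsProjection.inner_eq {Q : K → K} (hQ : IsProjection ℂ Q) (k l : K) :
    inner ℂ (Q k) l = inner ℂ k (Q l) := hQ.self_adjoint k l

theorem IsProjectionDecomposition.norm_sum_le {n : ℕ} {Q : Fin n → K → K}
    (hQ : IsProjectionDecomposition ℂ Q) (k : Fin n → K) : ‖∑ i, Q i (k i)‖ ≤ ∑ i, ‖k i‖ :=
  (_root_.norm_sum_le _ _).trans (Finset.sum_le_sum fun i _ => (hQ.isProjection i).norm_le _)

theorem bddAbove_hilbertMultiNorm {n : ℕ} (k : Fin n → K) :
    BddAbove {r : ℝ | ∃ Q : Fin n → K → K, IsProjectionDecomposition ℂ Q ∧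
      r = ‖∑ i, Q i (k i)‖} :=
  ⟨∑ i, ‖k i‖, by rintro _ ⟨Q, hQ, rfl⟩; exact hQ.norm_sum_le k⟩

theorem hilbertMultiNorm_le_sum {n : ℕ} (k : Fin n → K) :
    hilbertMultiNorm ℂ k ≤ ∑ i, ‖k i‖ :=
  Real.sSup_le (by rintro _ ⟨Q, hQ, rfl⟩; exact hQ.norm_sum_le k)
    (Finset.sum_nonneg fun _ _ => norm_nonneg _)

end HilbertSpace

theorem hilbertMultiNorm_nonneg {A X : Type*} [NonUnitalCStarAlgebra A] [PartialOrder A]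
    [NormedAddCommGroup X] [NormedSpace ℂ X] [SMul A X] [CStarModule A X] {n : ℕ} (x : Fin n → X) :
    0 ≤ hilbertMultiNorm A x :=
  Real.sSup_nonneg (by rintro _ ⟨P, -, rfl⟩; exact norm_nonneg _)

section Transfer

variable {H : Type*} [NormedAddCommGroup H] [InnerProductSpace ℂ H] [CompleteSpace H]
  {X : Type*} [NormedAddCommGroup X] [NormedSpace ℂ X]
  [SMul (CompactOp H)ᵐᵒᵖ X] [CStarModule (CompactOp H)ᵐᵒᵖ X]

theorem IsProjection.rinner_eq {P : X → X} (hP : IsProjection (CompactOp H)ᵐᵒᵖ P) (x y : X) :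
    rinner (CompactOp H) (P x) y = rinner (CompactOp H) x (P y) :=
  congrArg MulOpposite.unop (hP.self_adjoint x y)

variable (H) in
/-- The norm of a Hilbert `𝕂(H)`-module is the supremum of the norms in the localizations. -/
theorem norm_le_of_forall_toLocalization [Nontrivial H] {x : X} {c : ℝ} (hc : 0 ≤ c)
    (h : ∀ (ζ : H) (hζ : ‖ζ‖ = 1), ‖toLocalization (vectorState ζ hζ) x‖ ≤ c) : ‖x‖ ≤ c := by
  obtain ⟨ζ, hζ⟩ := exists_norm_eq H zero_le_one
  rw [← (vectorLocalization X ζ hζ).toOp.norm_map]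
  refine ContinuousLinearMap.opNorm_le_of_unit_norm (𝕜 := ℂ) hc fun η hη => ?_
  -- In the representation at the single vector ζ, ‖xη‖² = ⟨η, ⟨x, x⟩η⟩, which is the squared length
  -- of x at the state of η.
  refine le_trans (le_of_eq ?_) (h η hη)
  rw [← sq_eq_sq₀ (norm_nonneg _) (norm_nonneg _), ← inner_self_eq_norm_sq (𝕜 := ℂ),
    ← inner_self_eq_norm_sq (𝕜 := ℂ), VectorLocalization.inner_toOp]
  exact congrArg _ ((vectorLocalization X η hη).inner_map x x).symm

namespace VectorLocalization

variable {ζ : H} {K : Type*} [NormedAddCommGroup K] [InnerProductSpace ℂ K] [CompleteSpace K]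
  (L : VectorLocalization ζ X K)

/-- A projection on the module induces one on every localization. -/
theorem exists_induced_projection {P : X → X} (hP : IsProjection (CompactOp H)ᵐᵒᵖ P) :
    ∃ Q : K →L[ℂ] K, IsProjection ℂ Q ∧ ∀ x, Q (L.toLin x) = L.toLin (P x) := by
  let Pₗ : X →ₗ[ℂ] X := { toFun := P, map_add' := hP.map_add, map_smul' := hP.map_smul }
  -- Orthogonal projection onto the closure of the image of P: self-adjointness and idempotence of P
  -- make [x] - [Px] orthogonal to it.
  let V : Submodule ℂ K := (LinearMap.range (L.toLin ∘ₗ Pₗ)).topologicalClosure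
  have : CompleteSpace V := (Submodule.isClosed_topologicalClosure _).completeSpace_coe
  refine ⟨V.starProjection, ⟨fun x y => V.inner_starProjection_left_eq_right x y, fun x => ?_⟩,
    fun x => ?_⟩
  · exact Submodule.starProjection_eq_self_iff.2 (Submodule.starProjection_apply_mem V x)
  · refine (Submodule.eq_starProjection_of_mem_orthogonal
      (Submodule.le_topologicalClosure _ ⟨x, rfl⟩) ?_)
    rw [Submodule.orthogonal_closure, Submodule.mem_orthogonal]
    rintro _ ⟨y, rfl⟩
    change inner ℂ (L.toLin (P y)) (L.toLin x - L.toLin (P x)) = 0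
    rw [inner_sub_right, L.inner_map, L.inner_map, hP.rinner_eq, hP.rinner_eq, hP.idempotent,
      sub_self]

/-- The relations hold on the dense image of X and extend by continuity. -/
theorem exists_induced_decomposition {n : ℕ} {P : Fin n → X → X}
    (hP : IsProjectionDecomposition (CompactOp H)ᵐᵒᵖ P) :
    ∃ Q : Fin n → K → K, IsProjectionDecomposition ℂ Q ∧
      ∀ i x, Q i (L.toLin x) = L.toLin (P i x) := by
  choose Q hQ hQP using fun i => L.exists_induced_projection (hP.isProjection i)
  refine ⟨fun i => Q i, ⟨hQ, fun i j hij => ?_, ?_⟩, hQP⟩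
  · refine congrFun (L.dense.equalizer ((Q i).continuous.comp (Q j).continuous)
      continuous_const (funext fun x => ?_))
    simp [hQP, hP.orthogonal i j hij]
  · refine congrFun (L.dense.equalizer (continuous_finsetSum _ fun i _ => (Q i).continuous)
      continuous_id (funext fun x => ?_))
    simp [hQP, ← map_sum, hP.sum_eq]

variable [CompleteSpace X]

/-- A projection decomposition of a localization lifts to the module. -/
theorem exists_lifted_decomposition {n : ℕ} {Q : Fin n → K → K}
    (hQ : IsProjectionDecomposition ℂ Q) :
    ∃ P : Fin n → X → X, IsProjectionDecomposition (CompactOp H)ᵐᵒᵖ P ∧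
      ∀ i x, Q i (L.toLin x) = L.toLin (P i x) := by
  choose P hP using fun i => L.exists_toOp_eq_comp (hQ.isProjection i).toCLM
  have hPη : ∀ i x η, L.toOp (P i x) η = Q i (L.toOp x η) := fun i x η => by rw [hP]; rfl
  refine ⟨P, ⟨fun i => ⟨fun x y => ?_, fun x => ?_⟩, fun i j hij x => ?_, fun x => ?_⟩,
    fun i x => ?_⟩
  · refine MulOpposite.unop_injective (CompactOp.ext_apply fun η => ext_inner_left ℂ fun ξ => ?_)
    have h1 := L.inner_toOp (P i x) y ξ η
    have h2 := L.inner_toOp x (P i y) ξ η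
    rw [hPη, (hQ.isProjection i).inner_eq, ← hPη, h2] at h1
    exact h1.symm
  · refine L.toOp.injective (ContinuousLinearMap.ext fun η => ?_)
    rw [hPη, hPη, (hQ.isProjection i).idempotent]
  · refine L.toOp.injective (ContinuousLinearMap.ext fun η => ?_)
    rw [hPη, hPη, hQ.orthogonal i j hij, map_zero, zero_apply]
  · refine L.toOp.injective (ContinuousLinearMap.ext fun η => ?_)
    rw [map_sum, sum_apply]
    simp_rw [hPη]
    exact hQ.sum_eq _
  · rw [← toOp_apply_self, ← toOp_apply_self, hPη]

end VectorLocalization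

/-- Makes the set defining the multi-norm bounded, so that its real supremum is a genuine one. -/
theorem IsProjectionDecomposition.norm_sum_le_module [Nontrivial H] {n : ℕ} {P : Fin n → X → X}
    (hP : IsProjectionDecomposition (CompactOp H)ᵐᵒᵖ P) (x : Fin n → X) :
    ‖∑ i, P i (x i)‖ ≤ ∑ i, ‖x i‖ := by
  refine norm_le_of_forall_toLocalization H (Finset.sum_nonneg fun _ _ => norm_nonneg _)
    fun ζ hζ => ?_
  let L := vectorLocalization X ζ hζ
  obtain ⟨Q, hQ, hQP⟩ := L.exists_induced_decomposition hP
  change ‖L.toLin _‖ ≤ _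
  rw [map_sum]
  simp_rw [← hQP]
  exact (hQ.norm_sum_le _).trans (Finset.sum_le_sum fun i _ => L.norm_toLin_le _)

theorem bddAbove_hilbertMultiNorm_module [Nontrivial H] {n : ℕ} (x : Fin n → X) :
    BddAbove {r : ℝ | ∃ P : Fin n → X → X, IsProjectionDecomposition (CompactOp H)ᵐᵒᵖ P ∧
      r = ‖∑ i, P i (x i)‖} :=
  ⟨∑ i, ‖x i‖, by rintro _ ⟨P, hP, rfl⟩; exact hP.norm_sum_le_module x⟩

/-- Decompositions of K lift to X, and passing to the localization is contractive. -/
theorem VectorLocalization.hilbertMultiNorm_le [Nontrivial H] [CompleteSpace X] {ζ : H} {K : Type*}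
    [NormedAddCommGroup K] [InnerProductSpace ℂ K] [CompleteSpace K]
    (L : VectorLocalization ζ X K) {n : ℕ} (x : Fin n → X) :
    hilbertMultiNorm ℂ (fun i => L.toLin (x i)) ≤ hilbertMultiNorm (CompactOp H)ᵐᵒᵖ x := by
  refine Real.sSup_le ?_ (hilbertMultiNorm_nonneg x)
  rintro _ ⟨Q, hQ, rfl⟩
  obtain ⟨P, hP, hQP⟩ := L.exists_lifted_decomposition hQ
  simp_rw [hQP, ← map_sum]
  exact (L.norm_toLin_le _).trans (le_csSup (bddAbove_hilbertMultiNorm_module x) ⟨P, hP, rfl⟩)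

theorem bddAbove_pureStateMultiNorm {n : ℕ} (x : Fin n → X) :
    BddAbove {r : ℝ | ∃ τ : PureState (CompactOp H),
      r = hilbertMultiNorm ℂ (fun i => toLocalization τ (x i))} := by
  refine ⟨∑ i, ‖x i‖, ?_⟩
  rintro _ ⟨τ, rfl⟩
  obtain ⟨ζ, hζ, rfl⟩ := exists_eq_vectorState τ
  exact (hilbertMultiNorm_le_sum _).trans
    (Finset.sum_le_sum fun i _ => (vectorLocalization X ζ hζ).norm_toLin_le _)

variable (H) in
theorem eq_zero_of_subsingleton [Subsingleton H] (x : X) : x = 0 := by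
  have : rinner (CompactOp H) x x = 0 := CompactOp.ext_apply fun η => Subsingleton.elim _ _
  rw [← norm_eq_zero, ← sq_eq_zero_iff, norm_sq_eq_norm_rinner (CompactOp H), this, norm_zero]

/-- The multi-norm of a Hilbert `𝕂(H)`-module is the supremum of the Hilbert multi-norms of its
localizations at pure states. -/
theorem hilbertMultiNorm_eq_pureStateMultiNorm [CompleteSpace X] {n : ℕ} (x : Fin n → X) :
    hilbertMultiNorm (CompactOp H)ᵐᵒᵖ x = pureStateMultiNorm (CompactOp H) x := by
  rcases subsingleton_or_nontrivial H with hH | hH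
  · have hX : ∀ y : X, y = 0 := eq_zero_of_subsingleton H
    have h2 : pureStateMultiNorm (CompactOp H) x ≤ 0 := by
      refine Real.sSup_le ?_ le_rfl
      rintro _ ⟨τ, rfl⟩
      obtain ⟨ζ, hζ, rfl⟩ := exists_eq_vectorState τ
      exact absurd hζ (by simp [Subsingleton.elim ζ 0])
    have h3 : 0 ≤ pureStateMultiNorm (CompactOp H) x :=
      Real.sSup_nonneg (by rintro _ ⟨τ, rfl⟩; exact hilbertMultiNorm_nonneg _)
    refine le_antisymm (Real.sSup_le ?_ h3) (h2.trans (hilbertMultiNorm_nonneg _))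
    rintro _ ⟨P, -, rfl⟩
    rw [hX (∑ i, P i (x i)), norm_zero]
    exact h3
  · have h3 : 0 ≤ pureStateMultiNorm (CompactOp H) x :=
      Real.sSup_nonneg (by rintro _ ⟨τ, rfl⟩; exact hilbertMultiNorm_nonneg _)
    refine le_antisymm (Real.sSup_le ?_ h3) (Real.sSup_le ?_ (hilbertMultiNorm_nonneg _))
    · rintro _ ⟨P, hP, rfl⟩
      refine norm_le_of_forall_toLocalization H h3 fun ζ hζ => ?_
      refine le_trans ?_ (le_csSup (bddAbove_pureStateMultiNorm x) ⟨vectorState ζ hζ, rfl⟩)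
      let L := vectorLocalization X ζ hζ
      obtain ⟨Q, hQ, hQP⟩ := L.exists_induced_decomposition hP
      refine le_csSup (bddAbove_hilbertMultiNorm _) ⟨Q, hQ, ?_⟩
      change ‖L.toLin _‖ = ‖∑ i, Q i (L.toLin (x i))‖
      rw [map_sum]
      simp_rw [hQP]
    · rintro _ ⟨τ, rfl⟩
      obtain ⟨ζ, hζ, rfl⟩ := exists_eq_vectorState τ
      exact (vectorLocalization X ζ hζ).hilbertMultiNorm_le x

end Transfer

/-! ### Contractive families and orthonormal families in a Hilbert space -/

section Contractive

variable {K : Type*} [NormedAddCommGroup K] [InnerProductSpace ℂ K]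

theorem exists_orthonormal_of_le_rank {n : ℕ} (h : (n : Cardinal) ≤ Module.rank ℂ K) :
    ∃ w : Fin n → K, Orthonormal ℂ w := by
  obtain ⟨v, hv⟩ := Module.le_rank_iff.1 h
  exact ⟨_, InnerProductSpace.gramSchmidtNormed_orthonormal hv⟩

/-- In a space of sufficiently large dimension, mutually orthogonal vectors are multiples of
orthonormal vectors. -/
theorem exists_orthonormal_eq_norm_smul {n : ℕ} (h : (n : Cardinal) ≤ Module.rank ℂ K)
    {v : Fin n → K} (hv : Pairwise fun a b => inner ℂ (v a) (v b) = 0) :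
    ∃ u : Fin n → K, Orthonormal ℂ u ∧ ∀ a, v a = (‖v a‖ : ℂ) • u a := by
  obtain ⟨w, hw⟩ := exists_orthonormal_of_le_rank h
  let F : Submodule ℂ K := Submodule.span ℂ (Set.range w ∪ Set.range v)
  have hF : FiniteDimensional ℂ F :=
    FiniteDimensional.span_of_finite ℂ ((Set.finite_range w).union (Set.finite_range v))
  have hwF : ∀ a, w a ∈ F := fun a => Submodule.subset_span (Or.inl ⟨a, rfl⟩)
  have hvF : ∀ a, v a ∈ F := fun a => Submodule.subset_span (Or.inr ⟨a, rfl⟩)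
  have hn : n ≤ Module.finrank ℂ F := by
    have : LinearIndependent ℂ fun a => (⟨w a, hwF a⟩ : F) :=
      LinearIndependent.of_comp F.subtype hw.linearIndependent
    simpa using this.fintype_card_le_finrank
  -- Padded by zeros to the length of a basis: Gram–Schmidt normalizes the nonzero vectors of an
  -- orthogonal family and fills the vacant places. Adjoining w to F ensures n places.
  let f : Fin (Module.finrank ℂ F) → F := fun a => if ha : a.1 < n then ⟨v ⟨a, ha⟩, hvF _⟩ else 0
  have hf : Pairwise fun a b => inner ℂ (f a) (f b) = 0 := by
    intro a b hab
    by_cases ha : a.1 < n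
    · by_cases hb : b.1 < n
      · simp only [f, dif_pos ha, dif_pos hb]
        exact hv fun h => hab (Fin.ext (Fin.mk.inj_iff.1 h))
      · simp [f, dif_neg hb]
    · simp [f, dif_neg ha]
  let b := InnerProductSpace.gramSchmidtOrthonormalBasis
    (show Module.finrank ℂ F = Fintype.card (Fin (Module.finrank ℂ F)) by simp) f
  refine ⟨fun a => b (Fin.castLE hn a), ?_, fun a => ?_⟩
  · have := b.orthonormal.comp _ (Fin.castLE_injective hn)
    exact this.comp_linearIsometry F.subtypeₗᵢ
  · rcases eq_or_ne (v a) 0 with h0 | h0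
    · simp [h0]
    · have hfa : f (Fin.castLE hn a) = ⟨v a, hvF a⟩ := by simp [f]
      have hb : b (Fin.castLE hn a) = ((‖v a‖⁻¹ : ℝ) : ℂ) • (⟨v a, hvF a⟩ : F) := by
        have := InnerProductSpace.gramSchmidtOrthonormalBasis_apply_of_orthogonal
          (show Module.finrank ℂ F = Fintype.card (Fin (Module.finrank ℂ F)) by simp) hf
          (i := Fin.castLE hn a) (by rw [hfa]; simpa [Subtype.ext_iff] using h0)
        rw [hfa] at this
        rw [Complex.ofReal_inv]
        exact this
      change v a = (‖v a‖ : ℂ) • (b (Fin.castLE hn a) : K)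
      rw [hb, Submodule.coe_smul, smul_smul, ← Complex.ofReal_mul,
        mul_inv_cancel₀ (norm_ne_zero_iff.2 h0), Complex.ofReal_one, one_smul]

/-- Singular value decomposition of a contractive family. -/
theorem exists_singular_values {n : ℕ} (h : (n : Cardinal) ≤ Module.rank ℂ K) {k : Fin n → K}
    (hk : ∀ g, ∑ i, ‖inner ℂ (k i) g‖ ^ 2 ≤ ‖g‖ ^ 2) :
    ∃ (e : OrthonormalBasis (Fin n) ℂ (EuclideanSpace ℂ (Fin n))) (u : Fin n → K)
      (s : Fin n → ℝ), Orthonormal ℂ u ∧ (∀ a, s a ∈ Set.Icc (-1 : ℝ) 1) ∧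
      ∀ i, k i = ∑ a, ((s a : ℂ) * inner ℂ (e a) (EuclideanSpace.single i 1)) • u a := by
  -- C sends the i-th basis vector to kᵢ, and D is its adjoint. The hypothesis says that D, hence C,
  -- is a contraction. An eigenbasis of DC has orthogonal images under C, whose lengths are the
  -- singular values.
  let C : EuclideanSpace ℂ (Fin n) →ₗ[ℂ] K :=
    { toFun c := ∑ i, c i • k i
      map_add' c d := by simp [add_smul, Finset.sum_add_distrib]
      map_smul' t c := by simp [Finset.smul_sum, smul_smul] }
  let D : K →ₗ[ℂ] EuclideanSpace ℂ (Fin n) :=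
    { toFun g := WithLp.toLp 2 fun i => inner ℂ (k i) g
      map_add' g g' := by ext; simp
      map_smul' t g := by ext; simp }
  have hD : ∀ g, ‖D g‖ ≤ ‖g‖ := fun g => by
    refine le_of_sq_le_sq ?_ (norm_nonneg g)
    rw [EuclideanSpace.norm_sq_eq]
    exact hk g
  have hCD : ∀ c g, inner ℂ (C c) g = inner ℂ c (D g) := fun c g => by
    simp only [C, D, LinearMap.coe_mk, AddHom.coe_mk, sum_inner, inner_smul_left,
      PiLp.inner_apply, RCLike.inner_apply]
    exact Finset.sum_congr rfl fun i _ => mul_comm _ _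
  have hDC : ∀ c g, inner ℂ (D g) c = inner ℂ g (C c) := fun c g => by
    rw [← inner_conj_symm, ← hCD, inner_conj_symm]
  have hC : ∀ c, ‖C c‖ ≤ ‖c‖ := fun c => by
    have h1 : ‖C c‖ * ‖C c‖ ≤ ‖c‖ * ‖C c‖ := by
      rw [← norm_inner_self, hCD]
      exact (norm_inner_le_norm _ _).trans (mul_le_mul_of_nonneg_left (hD _) (norm_nonneg _))
    rcases (norm_nonneg (C c)).eq_or_lt with h0 | h0
    · rw [← h0]; exact norm_nonneg _
    · exact le_of_mul_le_mul_right h1 h0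
  have hS : (D ∘ₗ C).IsSymmetric := fun c d => by
    rw [LinearMap.comp_apply, LinearMap.comp_apply, hDC, hCD]
  let e := hS.eigenvectorBasis (n := n) (by simp)
  have hv : Pairwise fun a b => inner ℂ (C (e a)) (C (e b)) = 0 := fun a b hab => by
    change inner ℂ (C (e a)) (C (e b)) = 0
    rw [hCD, ← LinearMap.comp_apply, hS.apply_eigenvectorBasis, inner_smul_right]
    change _ * inner ℂ (e a) (e b) = 0
    rw [e.orthonormal.2 hab, mul_zero]
  obtain ⟨u, hu, huv⟩ := exists_orthonormal_eq_norm_smul h hv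
  refine ⟨e, u, fun a => ‖C (e a)‖, hu, fun a => ⟨by linarith [norm_nonneg (C (e a))], ?_⟩,
    fun i => ?_⟩
  · exact (hC _).trans (e.orthonormal.1 a).le
  · have h1 : C (EuclideanSpace.single i 1) = k i := by
      simp [C]
    rw [← h1]
    conv_lhs => rw [← e.sum_repr' (EuclideanSpace.single i 1), map_sum]
    refine Finset.sum_congr rfl fun a _ => ?_
    rw [map_smul, mul_comm, mul_smul, ← huv a]

/-- A contractive family is dominated by an orthonormal one. -/
theorem exists_orthonormal_sum_le {n : ℕ} (hrank : (n : Cardinal) ≤ Module.rank ℂ K)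
    {k : Fin n → K} (hk : ∀ g, ∑ i, ‖inner ℂ (k i) g‖ ^ 2 ≤ ‖g‖ ^ 2) (h : Fin n → K) :
    ∃ u : Fin n → K, Orthonormal ℂ u ∧
      ∑ i, ‖inner ℂ (k i) (h i)‖ ^ 2 ≤ ∑ i, ‖inner ℂ (u i) (h i)‖ ^ 2 := by
  obtain ⟨e, u, s, hu, hs, hks⟩ := exists_singular_values hrank hk
  -- The family with the singular values replaced by t, so that w s = k. Since ‖ℓ t‖ is convex in t
  -- and s lies in the cube [-1, 1]ⁿ, some vertex t does at least as well.
  let w : (Fin n → ℝ) → Fin n → K := fun t i =>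
    ∑ a, ((t a : ℂ) * inner ℂ (e a) (EuclideanSpace.single i 1)) • u a
  let ℓ : (Fin n → ℝ) →ₗ[ℝ] EuclideanSpace ℂ (Fin n) :=
    { toFun t := WithLp.toLp 2 fun i => inner ℂ (w t i) (h i)
      map_add' t t' := by
        ext i
        simp [w, add_mul, add_smul, Finset.sum_add_distrib]
      map_smul' c t := by
        ext i
        simp only [w, Pi.smul_apply, smul_eq_mul, Complex.ofReal_mul, sum_inner, inner_smul_left,
          map_mul, Complex.conj_ofReal, RingHom.id_apply, PiLp.smul_apply, Complex.real_smul,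
          Finset.mul_sum, mul_assoc] }
  have hmem : s ∈ convexHull ℝ (Set.univ.pi fun _ : Fin n => ({-1, 1} : Set ℝ)) := by
    rw [convexHull_pi]
    intro a _
    rw [convexHull_pair, segment_eq_Icc (by norm_num)]
    exact hs a
  obtain ⟨t, ht, hst⟩ := (convexOn_univ_norm.comp_linearMap ℓ).exists_ge_of_mem_convexHull
    (Set.subset_univ _) hmem
  have ht2 : ∀ a, (t a : ℂ) * (t a : ℂ) = 1 := fun a => by
    have h0 : t a = -1 ∨ t a = 1 := ht a (Set.mem_univ a)
    rcases h0 with h1 | h1 <;> simp [h1]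
  refine ⟨w t, ?_, ?_⟩
  -- At a vertex tₐ² = 1, so the Gram matrix is that of the standard basis by Parseval for e.
  · rw [orthonormal_iff_ite]
    intro i j
    rw [hu.inner_sum]
    have : ∀ a, (starRingEnd ℂ) ((t a : ℂ) * inner ℂ (e a) (EuclideanSpace.single i 1)) *
        ((t a : ℂ) * inner ℂ (e a) (EuclideanSpace.single j 1)) =
        inner ℂ (EuclideanSpace.single i 1) (e a) * inner ℂ (e a) (EuclideanSpace.single j 1) := by
      intro a
      rw [map_mul, inner_conj_symm, Complex.conj_ofReal]
      linear_combination (inner ℂ (EuclideanSpace.single i (1 : ℂ)) (e a) *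
        inner ℂ (e a) (EuclideanSpace.single j (1 : ℂ))) * ht2 a
    rw [Finset.sum_congr rfl fun a _ => this a, e.sum_inner_mul_inner]
    exact orthonormal_iff_ite.1 (EuclideanSpace.orthonormal_single) i j
  · have h1 : ‖ℓ s‖ ^ 2 ≤ ‖ℓ t‖ ^ 2 := by gcongr; exact hst
    rw [EuclideanSpace.norm_sq_eq, EuclideanSpace.norm_sq_eq] at h1
    simp only [hks]
    exact h1

theorem IsProjectionDecomposition.norm_sum_sq {n : ℕ} {Q : Fin n → K → K}
    (hQ : IsProjectionDecomposition ℂ Q) (k : Fin n → K) :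
    ‖∑ i, Q i (k i)‖ ^ 2 = ∑ i, ‖Q i (k i)‖ ^ 2 := by
  have : (∑ i, inner ℂ (Q i (k i)) (∑ j, Q j (k j))) = ∑ i, inner ℂ (Q i (k i)) (Q i (k i)) := by
    refine Finset.sum_congr rfl fun i _ => ?_
    rw [inner_sum, Finset.sum_eq_single i]
    · intro j _ hji
      rw [(hQ.isProjection i).inner_eq, hQ.orthogonal i j hji.symm, inner_zero_right]
    · simp
  rw [← inner_self_eq_norm_sq (𝕜 := ℂ), sum_inner, this, map_sum]
  exact Finset.sum_congr rfl fun i _ => inner_self_eq_norm_sq _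

/-- An orthonormal family is subordinate to a projection decomposition. -/
theorem exists_decomposition_of_orthonormal {n : ℕ} [NeZero n] {u : Fin n → K}
    (hu : Orthonormal ℂ u) :
    ∃ Q : Fin n → K → K, IsProjectionDecomposition ℂ Q ∧
      ∀ i k, ‖inner ℂ (u i) k‖ ≤ ‖Q i k‖ := by
  let q : Fin n → K →L[ℂ] K := fun i => InnerProductSpace.rankOne ℂ (u i) (u i)
  have hqsa : ∀ i x y, inner ℂ (q i x) y = inner ℂ x (q i y) := fun i x y => by
    simp [q, mul_comm]
  have hqq : ∀ i x, q i (q i x) = q i x := fun i x => by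
    simp [q, hu.1 i]
  have hqz : ∀ i j x, i ≠ j → q i (q j x) = 0 := fun i j x hij => by
    simp [q, hu.2 hij]
  let W : K →L[ℂ] K := ∑ j ∈ Finset.univ.erase 0, q j
  have hWsa : ∀ x y, inner ℂ (W x) y = inner ℂ x (W y) := fun x y => by
    simp only [W, sum_apply, sum_inner, inner_sum, hqsa]
  have hqW : ∀ i x, i ≠ 0 → q i (W x) = q i x := fun i x hi => by
    simp only [W, sum_apply, map_sum]
    rw [Finset.sum_eq_single_of_mem i (by simp [hi]) fun j _ hji => hqz i j x hji.symm, hqq]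
  have hWq : ∀ i x, i ≠ 0 → W (q i x) = q i x := fun i x hi => by
    simp only [W, sum_apply]
    rw [Finset.sum_eq_single_of_mem i (by simp [hi]) fun j _ hji => hqz j i x hji, hqq]
  have hW0 : ∀ x, W (q 0 x) = 0 := fun x => by
    simp only [W, sum_apply]
    exact Finset.sum_eq_zero fun j hj => hqz j 0 x (Finset.ne_of_mem_erase hj)
  have hWW : ∀ x, W (W x) = W x := fun x => by
    have h1 : ∀ y, W y = ∑ j ∈ Finset.univ.erase 0, q j y := fun y => sum_apply _ _ _
    exact (h1 _).trans ((Finset.sum_congr rfl fun j hj =>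
      hqW j x (Finset.ne_of_mem_erase hj)).trans (h1 x).symm)
  -- Index 0 absorbs the complement of the other lines, so the projections sum to the identity; its
  -- range still contains u 0.
  let Q : Fin n → K → K := fun i x => if i = 0 then x - W x else q i x
  have hQ : IsProjectionDecomposition ℂ Q := by
    refine ⟨fun i => ⟨fun x y => ?_, fun x => ?_⟩, fun i j hij x => ?_, fun x => ?_⟩
    · change inner ℂ (Q i x) y = inner ℂ x (Q i y)
      by_cases hi : i = 0
      · simp only [Q, if_pos hi]
        rw [inner_sub_left, inner_sub_right, hWsa]
      · simp only [Q, if_neg hi, hqsa]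
    · by_cases hi : i = 0
      · simp only [Q, if_pos hi, map_sub, hWW, sub_self, sub_zero]
      · simp only [Q, if_neg hi, hqq]
    · by_cases hi : i = 0
      · have hj : j ≠ 0 := fun h => hij (hi.trans h.symm)
        simp only [Q, if_pos hi, if_neg hj, hWq j x hj, sub_self]
      · by_cases hj : j = 0
        · simp only [Q, if_pos hj, if_neg hi, map_sub, hqW i x hi, sub_self]
        · simp only [Q, if_neg hj, if_neg hi, hqz i j x hij]
    · rw [← Finset.add_sum_erase _ _ (Finset.mem_univ (0 : Fin n))]
      have : ∑ i ∈ Finset.univ.erase 0, Q i x = W x := by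
        simp only [W, sum_apply]
        exact Finset.sum_congr rfl fun i hi => if_neg (Finset.ne_of_mem_erase hi)
      rw [this]
      simp [Q]
  refine ⟨Q, hQ, fun i k => ?_⟩
  have hQu : Q i (u i) = u i := by
    have hqu : q i (u i) = u i := by simp [q, hu.1 i]
    by_cases hi : i = 0
    · subst hi
      have := hW0 (u 0)
      rw [hqu] at this
      simp only [Q, if_true, this, sub_zero]
    · simp only [Q, if_neg hi, hqu]
  have h1 : inner ℂ (u i) k = inner ℂ (u i) (Q i k) := by
    rw [← (hQ.isProjection i).inner_eq, hQu]
  rw [h1]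
  simpa [hu.1 i] using norm_inner_le_norm (𝕜 := ℂ) (u i) (Q i k)

/-- The Hilbert multi-norm dominates pairings with contractive families. -/
theorem sum_norm_inner_sq_le_hilbertMultiNorm {n : ℕ} (hrank : (n : Cardinal) ≤ Module.rank ℂ K)
    {k : Fin n → K} (hk : ∀ g, ∑ i, ‖inner ℂ (k i) g‖ ^ 2 ≤ ‖g‖ ^ 2) (h : Fin n → K) :
    ∑ i, ‖inner ℂ (k i) (h i)‖ ^ 2 ≤ hilbertMultiNorm ℂ h ^ 2 := by
  rcases Nat.eq_zero_or_pos n with rfl | hn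
  · simpa using sq_nonneg _
  have : NeZero n := ⟨hn.ne'⟩
  obtain ⟨u, hu, hle⟩ := exists_orthonormal_sum_le hrank hk h
  obtain ⟨Q, hQ, hQu⟩ := exists_decomposition_of_orthonormal hu
  have h1 : ‖∑ i, Q i (h i)‖ ≤ hilbertMultiNorm ℂ h :=
    le_csSup (bddAbove_hilbertMultiNorm h) ⟨Q, hQ, rfl⟩
  calc _ ≤ ∑ i, ‖inner ℂ (u i) (h i)‖ ^ 2 := hle
    _ ≤ ∑ i, ‖Q i (h i)‖ ^ 2 := by gcongr with i; exact hQu i _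
    _ = ‖∑ i, Q i (h i)‖ ^ 2 := (hQ.norm_sum_sq h).symm
    _ ≤ _ := by gcongr

end Contractive

/-! ### The dual multi-norm -/

section StarNorm

variable {H : Type*} [NormedAddCommGroup H] [InnerProductSpace ℂ H] [CompleteSpace H]

theorem inner_sum_star_mul {n : ℕ} (b : Fin n → CompactOp H) (ξ η : H) :
    inner ℂ ξ (((∑ i, star (b i) * b i : CompactOp H) : H →L[ℂ] H) η) =
      ∑ i, inner ℂ ((b i : H →L[ℂ] H) ξ) ((b i : H →L[ℂ] H) η) := by
  rw [AddSubmonoidClass.coe_finsetSum, sum_apply, inner_sum]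
  exact Finset.sum_congr rfl fun i _ =>
    ContinuousLinearMap.adjoint_inner_right (b i : H →L[ℂ] H) _ _

theorem sum_norm_sq_le_norm_sum_star_mul {n : ℕ} (b : Fin n → CompactOp H) {η : H}
    (hη : ‖η‖ = 1) :
    ∑ i, ‖(b i : H →L[ℂ] H) η‖ ^ 2 ≤ ‖∑ i, star (b i) * b i‖ := by
  have h1 : ((∑ i, ‖(b i : H →L[ℂ] H) η‖ ^ 2 : ℝ) : ℂ) =
      inner ℂ η (((∑ i, star (b i) * b i : CompactOp H) : H →L[ℂ] H) η) := by
    rw [inner_sum_star_mul]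
    simp [inner_self_eq_norm_sq_to_K]
  have h2 : ‖((∑ i, ‖(b i : H →L[ℂ] H) η‖ ^ 2 : ℝ) : ℂ)‖ ≤ ‖∑ i, star (b i) * b i‖ := by
    rw [h1]
    refine (norm_inner_le_norm _ _).trans ?_
    rw [hη, one_mul]
    have h3 : ‖((∑ i, star (b i) * b i : CompactOp H) : H →L[ℂ] H) η‖ ≤
        ‖∑ i, star (b i) * b i‖ * ‖η‖ := ContinuousLinearMap.le_opNorm _ _
    rwa [hη, mul_one] at h3
  rw [Complex.norm_real] at h2
  exact (le_abs_self _).trans h2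

/-- With S = ∑ bᵢ⋆bᵢ, Cauchy–Schwarz for ‖Sη‖² = ∑ ⟨bᵢSη, bᵢη⟩ bounds it by c ‖Sη‖ ‖η‖. Together
with `sum_norm_sq_le_norm_sum_star_mul` this lets the norm of S be tested on unit vectors. -/
theorem norm_sum_star_mul_le {n : ℕ} (b : Fin n → CompactOp H) {c : ℝ} (hc : 0 ≤ c)
    (h : ∀ η : H, ‖η‖ = 1 → ∑ i, ‖(b i : H →L[ℂ] H) η‖ ^ 2 ≤ c) :
    ‖∑ i, star (b i) * b i‖ ≤ c := by
  have h' : ∀ η : H, ∑ i, ‖(b i : H →L[ℂ] H) η‖ ^ 2 ≤ c * ‖η‖ ^ 2 := fun η => by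
    rcases eq_or_ne η 0 with rfl | h0
    · simp
    · have h1 := h ((‖η‖⁻¹ : ℂ) • η) (by simp [norm_smul, h0])
      simp only [map_smul, norm_smul, mul_pow, ← Finset.mul_sum] at h1
      have h2 : 0 < ‖η‖ ^ 2 := by have := norm_pos_iff.2 h0; positivity
      simp only [norm_inv, Complex.norm_real, norm_norm, inv_pow] at h1
      rwa [inv_mul_le_iff₀ h2, mul_comm] at h1
  set S : H →L[ℂ] H := ((∑ i, star (b i) * b i : CompactOp H) : H →L[ℂ] H) with hS
  refine ContinuousLinearMap.opNorm_le_bound S hc fun η => ?_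
  have h1 : ‖S η‖ * ‖S η‖ ≤ (c * ‖η‖) * ‖S η‖ := by
    rw [← norm_inner_self, hS, inner_sum_star_mul, ← hS]
    calc _ ≤ ∑ i, ‖(b i : H →L[ℂ] H) (S η)‖ * ‖(b i : H →L[ℂ] H) η‖ :=
          (norm_sum_le _ _).trans (Finset.sum_le_sum fun i _ => norm_inner_le_norm _ _)
      _ ≤ √(∑ i, ‖(b i : H →L[ℂ] H) (S η)‖ ^ 2) * √(∑ i, ‖(b i : H →L[ℂ] H) η‖ ^ 2) :=
          Real.sum_mul_le_sqrt_mul_sqrt _ _ _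
      _ ≤ √(c * ‖S η‖ ^ 2) * √(c * ‖η‖ ^ 2) := by
          gcongr
          · exact h' _
          · exact h' _
      _ = (c * ‖η‖) * ‖S η‖ := by
          rw [Real.sqrt_mul hc, Real.sqrt_mul hc, Real.sqrt_sq (norm_nonneg _),
            Real.sqrt_sq (norm_nonneg _)]
          linear_combination ‖S η‖ * ‖η‖ * Real.mul_self_sqrt hc
  rcases (norm_nonneg (S η)).eq_or_lt with h0 | h0
  · rw [← h0]; positivity
  · exact le_of_mul_le_mul_right h1 h0

variable {X : Type*} [NormedAddCommGroup X] [NormedSpace ℂ X]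
  [SMul (CompactOp H)ᵐᵒᵖ X] [CStarModule (CompactOp H)ᵐᵒᵖ X]

/-- Since ⟨x, y⟩ = x⋆y in the representation, this is submultiplicativity of the operator norm. -/
theorem norm_rinner_le [Nontrivial H] (x y : X) :
    ‖rinner (CompactOp H) x y‖ ≤ ‖x‖ * ‖y‖ := by
  obtain ⟨ζ, hζ⟩ := exists_norm_eq H zero_le_one
  let L := vectorLocalization X ζ hζ
  refine ContinuousLinearMap.opNorm_le_bound (rinner (CompactOp H) x y : H →L[ℂ] H)
    (by positivity) fun η => ?_
  set v := (rinner (CompactOp H) x y : H →L[ℂ] H) η with hv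
  have h1 : ‖v‖ * ‖v‖ ≤ (‖x‖ * ‖y‖ * ‖η‖) * ‖v‖ := by
    rw [← norm_inner_self]
    conv_lhs => enter [1, 3]; rw [hv]
    rw [← L.inner_toOp]
    refine (norm_inner_le_norm _ _).trans ?_
    have h2 := (L.toOp x).le_opNorm v
    have h3 := (L.toOp y).le_opNorm η
    rw [L.toOp.norm_map] at h2 h3
    calc _ ≤ (‖x‖ * ‖v‖) * (‖y‖ * ‖η‖) := by gcongr
      _ = _ := by ring
  rcases (norm_nonneg v).eq_or_lt with h0 | h0
  · rw [← h0]; positivity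
  · exact le_of_mul_le_mul_right h1 h0

theorem bddAbove_muStar [Nontrivial H] {n : ℕ} (y : Fin n → X) :
    BddAbove {r : ℝ | ∃ z : X, ‖z‖ ≤ 1 ∧ r = √‖∑ i, star (rinner (CompactOp H) (y i) z) *
      rinner (CompactOp H) (y i) z‖} := by
  refine ⟨√(∑ i, ‖y i‖ * ‖y i‖), ?_⟩
  rintro _ ⟨z, hz, rfl⟩
  refine Real.sqrt_le_sqrt ((norm_sum_le _ _).trans (Finset.sum_le_sum fun i _ => ?_))
  have h1 : ‖rinner (CompactOp H) (y i) z‖ ≤ ‖y i‖ :=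
    (norm_rinner_le _ _).trans (mul_le_of_le_one_right (norm_nonneg _) hz)
  exact (norm_mul_le _ _).trans (mul_le_mul ((norm_star _).trans_le h1) h1 (norm_nonneg _)
    (norm_nonneg _))

theorem norm_sum_le_of_muStar_le_one [Nontrivial H] {n : ℕ} {y : Fin n → X}
    (hy : muStar (CompactOp H) y ≤ 1) (z : X) :
    ‖∑ i, star (rinner (CompactOp H) (y i) z) * rinner (CompactOp H) (y i) z‖ ≤ ‖z‖ ^ 2 := by
  rcases eq_or_ne z 0 with rfl | h0
  · have : ∀ i, rinner (CompactOp H) (y i) 0 = 0 := fun i => by simp [rinner]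
    simp [this]
  · have hz : 0 < ‖z‖ := norm_pos_iff.2 h0
    have h1 := (le_csSup (bddAbove_muStar y)
      ⟨(‖z‖⁻¹ : ℂ) • z, by simp [norm_smul, h0], rfl⟩).trans hy
    rw [Real.sqrt_le_one] at h1
    simp only [rinner_smul_right, star_smul, smul_mul_smul_comm, ← Finset.smul_sum,
      norm_smul] at h1
    have h2 : ‖star ((‖z‖ : ℂ)⁻¹) * (‖z‖ : ℂ)⁻¹‖ = (‖z‖ ^ 2)⁻¹ := by
      rw [norm_mul, norm_star, norm_inv, Complex.norm_real, norm_norm, sq, mul_inv]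
    rwa [h2, inv_mul_le_iff₀ (by positivity), mul_one] at h1

variable [CompleteSpace X]

namespace VectorLocalization

variable {ζ : H} {K : Type*} [NormedAddCommGroup K] [InnerProductSpace ℂ K] [CompleteSpace K]
  (L : VectorLocalization ζ X K)

/-- Pairings with families of `muStar` at most one are dominated by the Hilbert multi-norm of a
localization of large dimension. -/
theorem sum_norm_rinner_sq_le [Nontrivial H] {n : ℕ} (hrank : (n : Cardinal) ≤ Module.rank ℂ K)
    {y : Fin n → X} (hy : muStar (CompactOp H) y ≤ 1) (x : Fin n → X) :
    ∑ i, ‖(rinner (CompactOp H) (y i) (x i) : H →L[ℂ] H) ζ‖ ^ 2 ≤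
      hilbertMultiNorm ℂ (fun i => L.toLin (x i)) ^ 2 := by
  let v : Fin n → H := fun i => (rinner (CompactOp H) (y i) (x i) : H →L[ℂ] H) ζ
  -- Unit vectors along v i, or 0 when v i = 0 (the inverse of 0 is 0). Then kᵢ = yᵢwᵢ pairs with
  -- [xᵢ] to ‖v i‖.
  let w : Fin n → H := fun i => (‖v i‖⁻¹ : ℂ) • v i
  have hw : ∀ i, ‖w i‖ ≤ 1 := fun i => by
    rw [norm_smul, norm_inv, Complex.norm_real, norm_norm]
    exact inv_mul_le_one
  have hwv : ∀ i, ‖inner ℂ (w i) (v i)‖ = ‖v i‖ := fun i => by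
    rcases eq_or_ne (v i) 0 with h0 | h0
    · simp [h0]
    · rw [inner_smul_left, norm_mul, norm_inner_self]
      simp [h0]
  let k : Fin n → K := fun i => L.toOp (y i) (w i)
  have hk : ∀ i x, inner ℂ (k i) (L.toLin x) =
      inner ℂ (w i) ((rinner (CompactOp H) (y i) x : H →L[ℂ] H) ζ) := fun i x => by
    rw [← L.toOp_apply_self, L.inner_toOp]
  have hbessel : ∀ g, ∑ i, ‖inner ℂ (k i) g‖ ^ 2 ≤ ‖g‖ ^ 2 := fun g => by
    -- The element z represented by |g⟩⟨ζ| has class g and norm ‖g‖, so the `muStar` bound becomes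
    -- the Bessel inequality for k.
    obtain ⟨z, hz⟩ := L.exists_toOp_eq_rankOne g ζ
    have hzg : L.toLin z = g := by
      rw [← L.toOp_apply_self, hz]
      simp [L.norm_vec]
    have hzn : ‖z‖ = ‖g‖ := by
      rw [← L.toOp.norm_map, hz, InnerProductSpace.norm_rankOne, L.norm_vec, mul_one]
    rw [← hzn]
    refine le_trans ?_ ((sum_norm_sq_le_norm_sum_star_mul _ L.norm_vec).trans
      (norm_sum_le_of_muStar_le_one hy z))
    gcongr with i
    rw [← hzg, hk]
    exact (norm_inner_le_norm _ _).trans (mul_le_of_le_one_left (norm_nonneg _) (hw i))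
  refine le_trans (le_of_eq ?_) (sum_norm_inner_sq_le_hilbertMultiNorm hrank hbessel _)
  refine Finset.sum_congr rfl fun i _ => ?_
  rw [hk]
  exact congrArg (· ^ 2) (hwv i).symm

/-- A projection decomposition of a localization is realized by a family with `muStar` at most
one. -/
theorem exists_muStar_le_one {n : ℕ} {Q : Fin n → K → K} (hQ : IsProjectionDecomposition ℂ Q)
    (x : Fin n → X) :
    ∃ y : Fin n → X, muStar (CompactOp H) y ≤ 1 ∧ ‖∑ i, Q i (L.toLin (x i))‖ ≤
      √‖∑ i, star (rinner (CompactOp H) (y i) (x i)) * rinner (CompactOp H) (y i) (x i)‖ := by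
  let v : Fin n → K := fun i => Q i (L.toLin (x i))
  let k : Fin n → K := fun i => (‖v i‖⁻¹ : ℂ) • v i
  have hk : ∀ i, ‖k i‖ ≤ 1 := fun i => by
    rw [norm_smul, norm_inv, Complex.norm_real, norm_norm]
    exact inv_mul_le_one
  have hkQ : ∀ i g, inner ℂ (k i) g = inner ℂ (k i) (Q i g) := fun i g => by
    have : Q i (k i) = k i := by
      simp only [k, (hQ.isProjection i).map_smul, v, (hQ.isProjection i).idempotent]
    rw [← (hQ.isProjection i).inner_eq, this]
  have hkx : ∀ i, ‖inner ℂ (k i) (L.toLin (x i))‖ = ‖v i‖ := fun i => by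
    rw [hkQ]
    change ‖inner ℂ (k i) (v i)‖ = ‖v i‖
    rcases eq_or_ne (v i) 0 with h0 | h0
    · simp [h0]
    · rw [inner_smul_left, norm_mul, norm_inner_self]
      simp [h0]
  have hbessel : ∀ g, ∑ i, ‖inner ℂ (k i) g‖ ^ 2 ≤ ‖g‖ ^ 2 := fun g => by
    have h1 := hQ.norm_sum_sq fun _ => g
    rw [hQ.sum_eq] at h1
    rw [h1]
    gcongr with i
    rw [hkQ]
    exact (norm_inner_le_norm _ _).trans (mul_le_of_le_one_left (norm_nonneg _) (hk i))
  -- With yᵢ represented by |kᵢ⟩⟨ζ|, ⟨yᵢ, z⟩η = ⟨kᵢ, zη⟩ζ. Bessel for k gives the `muStar` bound,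
  -- and η = ζ recovers ∑ ‖Qᵢ[xᵢ]‖².
  choose y hy using fun i => L.exists_toOp_eq_rankOne (k i) ζ
  have hyz : ∀ i z η, (rinner (CompactOp H) (y i) z : H →L[ℂ] H) η =
      inner ℂ (k i) (L.toOp z η) • ζ := fun i z η => by
    refine ext_inner_left ℂ fun ξ => ?_
    rw [← L.inner_toOp, hy, InnerProductSpace.rankOne_apply, inner_smul_left, inner_smul_right,
      inner_conj_symm, mul_comm]
  have hyn : ∀ i z η, ‖(rinner (CompactOp H) (y i) z : H →L[ℂ] H) η‖ =
      ‖inner ℂ (k i) (L.toOp z η)‖ := fun i z η => by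
    rw [hyz, norm_smul, L.norm_vec, mul_one]
  refine ⟨y, Real.sSup_le ?_ zero_le_one, ?_⟩
  · rintro _ ⟨z, hz, rfl⟩
    rw [Real.sqrt_le_one]
    refine norm_sum_star_mul_le _ zero_le_one fun η hη => ?_
    simp_rw [hyn]
    refine (hbessel _).trans (pow_le_one₀ (norm_nonneg _) ?_)
    have := (L.toOp z).le_opNorm η
    rw [L.toOp.norm_map, hη, mul_one] at this
    exact this.trans hz
  · refine Real.le_sqrt_of_sq_le ?_
    refine le_trans (le_of_eq ?_) (sum_norm_sq_le_norm_sum_star_mul _ L.norm_vec)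
    rw [hQ.norm_sum_sq]
    simp_rw [hyn, L.toOp_apply_self, hkx]
    rfl

/-- A localization of small dimension yields a small orthonormal basis of the module. -/
theorem orthDim_le_finrank [FiniteDimensional ℂ K] (L : VectorLocalization ζ X K) :
    orthDim (CompactOp H) X ≤ Module.finrank ℂ K := by
  let b := stdOrthonormalBasis ℂ K
  -- The elements represented by |bₐ⟩⟨ζ| satisfy ⟨uₐ, u_c⟩ = ⟨bₐ, b_c⟩ |ζ⟩⟨ζ|. They generate because
  -- x |e⟩⟨e| is represented by |xe⟩⟨e|, which expands as ∑ ⟨bₐ, xe⟩ uₐ|ζ⟩⟨e|.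
  choose u hu using fun a => L.exists_toOp_eq_rankOne (b a) ζ
  have huu : ∀ a c, rinner (CompactOp H) (u a) (u c) =
      (inner ℂ (b a) (b c) : ℂ) • rankOneOp ζ ζ := fun a c => by
    refine CompactOp.ext_apply fun η => ext_inner_left ℂ fun ξ => ?_
    rw [← L.inner_toOp, hu, hu]
    simp [inner_smul_right]
    ring
  have hS : IsOrthonormalBasis (CompactOp H) X (Set.range u) := by
    refine ⟨?_, ?_, fun x => ?_⟩
    · rintro _ ⟨a, rfl⟩
      rw [huu, inner_self_eq_norm_sq_to_K, b.orthonormal.1 a]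
      simpa using isMinimalProjection_rankOneOp L.norm_vec
    · rintro _ ⟨a, rfl⟩ _ ⟨c, rfl⟩ hac
      rw [huu, b.orthonormal.2 fun h => hac (congrArg u h), zero_smul]
    · rw [Metric.mem_closure_iff]
      intro ε hε
      obtain ⟨F, _, hF⟩ := exists_norm_sub_projOp_smul_le (H := H) x (half_pos hε)
      refine ⟨MulOpposite.op (projOp F) • x, ?_, by rw [dist_eq_norm]; linarith⟩
      rw [projOp_eq_sum, ← orbitMap_apply, map_sum]
      refine Submodule.sum_mem _ fun i _ => ?_
      rw [orbitMap_apply]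
      set e : H := (stdOrthonormalBasis ℂ F i : H)
      have : MulOpposite.op (rankOneOp e e) • x =
          ∑ a, (inner ℂ (b a) (L.toOp x e) : ℂ) • MulOpposite.op (rankOneOp ζ e) • u a := by
        refine L.toOp.injective ?_
        rw [L.toOp_rankOneOp_smul, map_sum]
        simp_rw [map_smul, L.toOp_rankOneOp_smul, hu]
        conv_lhs => rw [← b.sum_repr' (L.toOp x e)]
        simp [L.norm_vec]
      rw [this]
      exact Submodule.sum_mem _ fun a _ => Submodule.smul_mem _ _
        (Submodule.subset_span (Or.inr ⟨u a, ⟨a, rfl⟩, _, rfl⟩))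
  have h1 : orthDim (CompactOp H) X ≤ Cardinal.mk (Set.range u) := csInf_le' ⟨_, hS, rfl⟩
  refine h1.trans ?_
  simpa using Cardinal.mk_range_le_lift (f := u)

end VectorLocalization

theorem hilbertMultiNorm_eq_starMultiNorm [Nontrivial H] {n : ℕ}
    (hn : (n : Cardinal) ≤ orthDim (CompactOp H) X) (x : Fin n → X) :
    hilbertMultiNorm (CompactOp H)ᵐᵒᵖ x = starMultiNorm (CompactOp H) x := by
  have key : ∀ y : Fin n → X, muStar (CompactOp H) y ≤ 1 →
      √‖∑ i, star (rinner (CompactOp H) (y i) (x i)) * rinner (CompactOp H) (y i) (x i)‖ ≤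
        hilbertMultiNorm (CompactOp H)ᵐᵒᵖ x := fun y hy => by
    refine Real.sqrt_le_iff.2 ⟨hilbertMultiNorm_nonneg x, ?_⟩
    refine norm_sum_star_mul_le _ (sq_nonneg _) fun ζ hζ => ?_
    let L := vectorLocalization X ζ hζ
    have hrank : (n : Cardinal) ≤ Module.rank ℂ (Localization (vectorState ζ hζ) X) := by
      by_contra! hlt
      have : FiniteDimensional ℂ (Localization (vectorState ζ hζ) X) :=
        Module.rank_lt_aleph0_iff.1 (hlt.trans (Cardinal.natCast_lt_aleph0))
      have h1 := hn.trans L.orthDim_le_finrank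
      rw [← Module.finrank_eq_rank] at hlt
      exact absurd (Nat.cast_lt.1 hlt) (not_lt.2 (Nat.cast_le.1 h1))
    refine (L.sum_norm_rinner_sq_le hrank hy x).trans ?_
    have := L.hilbertMultiNorm_le x
    have h0 := hilbertMultiNorm_nonneg (A := ℂ) (fun i => L.toLin (x i))
    gcongr
  refine le_antisymm ?_ (Real.sSup_le ?_ (hilbertMultiNorm_nonneg x))
  · rw [hilbertMultiNorm_eq_pureStateMultiNorm]
    have hnn : 0 ≤ starMultiNorm (CompactOp H) x :=
      Real.sSup_nonneg (by rintro _ ⟨y, -, rfl⟩; exact Real.sqrt_nonneg _)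
    refine Real.sSup_le ?_ hnn
    rintro _ ⟨τ, rfl⟩
    obtain ⟨ζ, hζ, rfl⟩ := exists_eq_vectorState τ
    refine Real.sSup_le ?_ hnn
    rintro _ ⟨Q, hQ, rfl⟩
    obtain ⟨y, hy, hle⟩ := (vectorLocalization X ζ hζ).exists_muStar_le_one hQ x
    refine hle.trans (le_csSup ⟨hilbertMultiNorm (CompactOp H)ᵐᵒᵖ x, ?_⟩ ⟨y, hy, rfl⟩)
    rintro _ ⟨y, hy, rfl⟩
    exact key y hy
  · rintro _ ⟨y, hy, rfl⟩
    exact key y hy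

theorem one_le_hilbertDim [Nontrivial H] : 1 ≤ hilbertDim H := by
  refine le_csInf ?_ ?_
  -- An orthonormal basis must be exhibited, since the infimum of an empty set of cardinals is 0.
  · obtain ⟨w, b, hb⟩ := exists_hilbertBasis ℂ H
    refine ⟨_, w, hb ▸ b.orthonormal, ?_, rfl⟩
    have := b.dense_span
    rw [hb, Subtype.range_coe] at this
    exact Submodule.dense_iff_topologicalClosure_eq_top.2 this
  · rintro _ ⟨S, -, hS, rfl⟩
    rw [Cardinal.one_le_iff_ne_zero, Cardinal.mk_ne_zero_iff]
    by_contra h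
    rw [not_nonempty_iff, Set.isEmpty_coe_sort] at h
    obtain ⟨η, hη⟩ := exists_ne (0 : H)
    have h1 := hS η
    rw [h, Submodule.span_empty, Submodule.bot_coe, closure_singleton] at h1
    exact hη h1

end StarNorm

end HilbertMulti

end

/-! ### The two equalities, including the degenerate space H = 0 -/

theorem mainTheorem3 {H : Type u} [NormedAddCommGroup H] [InnerProductSpace ℂ H]
    [CompleteSpace H] {X : Type v} [NormedAddCommGroup X] [NormedSpace ℂ X] [CompleteSpace X]
    [SMul (HilbertMulti.CompactOp H)ᵐᵒᵖ X] [CStarModule (HilbertMulti.CompactOp H)ᵐᵒᵖ X]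
    {n : ℕ} (x : Fin n → X) :
    HilbertMulti.hilbertMultiNorm (HilbertMulti.CompactOp H)ᵐᵒᵖ x =
        HilbertMulti.pureStateMultiNorm (HilbertMulti.CompactOp H) x ∧
      (TopologicalSpace.SeparableSpace H →
        (n : Cardinal.{max u v}) * Cardinal.lift.{v, u} (HilbertMulti.hilbertDim H) ≤
          Cardinal.lift.{u, v} (HilbertMulti.orthDim (HilbertMulti.CompactOp H) X) →
        HilbertMulti.hilbertMultiNorm (HilbertMulti.CompactOp H)ᵐᵒᵖ x =
          HilbertMulti.starMultiNorm (HilbertMulti.CompactOp H) x) := by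
  refine ⟨HilbertMulti.hilbertMultiNorm_eq_pureStateMultiNorm x, fun _ hdim => ?_⟩
  -- For H = 0 the module is zero and both norms vanish. Otherwise H has dimension at least 1, so
  -- the hypothesis gives n ≤ `orthDim`.
  rcases subsingleton_or_nontrivial H with hH | hH
  · refine le_antisymm (Real.sSup_le ?_ (Real.sSup_nonneg ?_))
      (Real.sSup_le ?_ (HilbertMulti.hilbertMultiNorm_nonneg x))
    · rintro _ ⟨P, -, rfl⟩
      rw [HilbertMulti.eq_zero_of_subsingleton H (∑ i, P i (x i)), norm_zero]
      exact Real.sSup_nonneg (by rintro _ ⟨y, -, rfl⟩; exact Real.sqrt_nonneg _)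
    · rintro _ ⟨y, -, rfl⟩
      exact Real.sqrt_nonneg _
    · rintro _ ⟨y, -, rfl⟩
      refine le_trans (le_of_eq ?_) (HilbertMulti.hilbertMultiNorm_nonneg x)
      rw [Real.sqrt_eq_zero', norm_le_zero_iff]
      exact HilbertMulti.CompactOp.ext_apply fun η => Subsingleton.elim _ _
  · refine HilbertMulti.hilbertMultiNorm_eq_starMultiNorm ?_ x
    have h1 : (1 : Cardinal.{max u v}) ≤ Cardinal.lift.{v, u} (HilbertMulti.hilbertDim H) := by
      rw [← Cardinal.lift_one.{u, v}, Cardinal.lift_le]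
      exact HilbertMulti.one_le_hilbertDim
    have h2 := (le_mul_of_one_le_right' h1).trans hdim
    rw [← Cardinal.lift_natCast.{u, v}, Cardinal.lift_le] at h2
    exact h2
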